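/- Let $0<m<n$ be integers. Let $\mathrm{Gr}(n,m)$ be the Grassmannian of $m$-dimensional linear subspaces of $\mathbb{R}^n$, let $\gamma_{n,m}$ be its rotation-invariant Borel probability measure, let $\pi_V\colon\mathbb{R}^n\to V$ be the orthogonal projection onto $V\in\mathrm{Gr}(n,m)$, and let $\mathcal{H}^m$ be the $m$-dimensional Hausdorff measure. For a finite Borel measure $\mu$ on $\mathbb{R}^n$, let $\pi_V\mu$ denote its push-forward under $\pi_V$, and let $(\mu_{V,y})_{y\in V}$ denote its disintegration along $\pi_V$: a family of Borel probability measures on $\mathbb{R}^n$, depending measurably on $y$, with $\mu_{V,y}$ concentrated on $\pi_V^{-1}(y)$ for $\pi_V\mu$-a.e. $y$ and $\mu(B)=\int_V\mu_{V,y}(B)\,d(\pi_V\mu)(y)$ for every Borel set $B\subset\mathbb{R}^n$. It is unique up to changes on a $\pi_V\mu$-null set of $y$; a property of $\mu_{V,y}$ is said to hold for $\mathcal{H}^m$-a.e. $y\in V$ if some version of the disintegration has it for $\mathcal{H}^m$-a.e. $y\in V$. A measure is purely atomic if it is concentrated on a countable set. A Borel set $R\subset\mathbb{R}^n$ is countably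 $m$-rectifiable if $R=\bigcup_{i\ge 1} f_i(E_i)$ with bounded sets $E_i\subset\mathbb{R}^m$ and Lipschitz maps $f_i\colon E_i\to\mathbb{R}^n$. A set $E\subset\mathbb{R}^n$ is purely $m$-unrectifiable if $\mathcal{H}^m(E\cap R)=0$ for every countably $m$-rectifiable set $R$. **Theorem.** Let $\mu$ be a finite Borel measure on $\mathbb{R}^n$ and let $\Sigma\subset\mathrm{Gr}(n,m)$ be a Borel set with $\gamma_{n,m}(\Sigma)>0$. Assume that for $\gamma_{n,m}$-a.e. $V\in\Sigma$ the measure $\mu_{V,y}$ is purely atomic for $\mathcal{H}^m$-a.e. $y\in V$. Then the following are equivalent: 1. for $\gamma_{n,m}$-a.e. $V\in\Sigma$, both $\pi_V\mu\perp\mathcal{H}^m$ and $\pi_V$ is injective on a set of full $\mu$-measure; 2. $\mu$ is concentrated on a purely $m$-unrectifiable set. -/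

import Mathlib

open MeasureTheory ProbabilityTheory
open scoped NNReal ENNReal

/-! ### The Grassmannian and its invariant probability measure -/

/-- The orthogonal group `O(n)`: the unitary elements (`g* g = g g* = 1`, where `*` is the adjoint)
of the algebra of linear endomorphisms of Euclidean space, with the operator norm topology. -/
abbrev OrthGroup (n : ℕ) : Type :=
  unitary (EuclideanSpace ℝ (Fin n) →L[ℝ] EuclideanSpace ℝ (Fin n))

instance OrthGroup.instContinuousStar (n : ℕ) :
    ContinuousStar (EuclideanSpace ℝ (Fin n) →L[ℝ] EuclideanSpace ℝ (Fin n)) :=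
  ⟨(ContinuousLinearMap.adjoint (𝕜 := ℝ) (E := EuclideanSpace ℝ (Fin n))
    (F := EuclideanSpace ℝ (Fin n))).continuous⟩

instance OrthGroup.instCompactSpace (n : ℕ) : CompactSpace (OrthGroup n) := by
  refine isCompact_iff_compactSpace.mp ?_
  have hcl : IsClosed ((unitary (EuclideanSpace ℝ (Fin n) →L[ℝ] EuclideanSpace ℝ (Fin n)) :
      Submonoid _) : Set (EuclideanSpace ℝ (Fin n) →L[ℝ] EuclideanSpace ℝ (Fin n))) := by
    have : ((unitary (EuclideanSpace ℝ (Fin n) →L[ℝ] EuclideanSpace ℝ (Fin n)) : Submonoid _) :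
        Set (EuclideanSpace ℝ (Fin n) →L[ℝ] EuclideanSpace ℝ (Fin n))) =
        {g | star g * g = 1} ∩ {g | g * star g = 1} := by
      ext g; exact Unitary.mem_iff
    rw [this]
    exact (isClosed_eq (by fun_prop) continuous_const).inter
      (isClosed_eq (by fun_prop) continuous_const)
  have : ProperSpace (EuclideanSpace ℝ (Fin n) →L[ℝ] EuclideanSpace ℝ (Fin n)) :=
    FiniteDimensional.proper ℝ _
  refine Metric.isCompact_of_isClosed_isBounded hcl ?_
  refine (Metric.isBounded_closedBall (x := 0) (r := 1)).subset fun g hg => ?_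
  rw [mem_closedBall_zero_iff]
  refine ContinuousLinearMap.opNorm_le_bound _ zero_le_one fun x => ?_
  have := (Unitary.linearIsometryEquiv ⟨g, hg⟩).norm_map x
  rw [one_mul]
  exact this.le

/-- The Grassmannian `Gr(n, m)` of `m`-dimensional linear subspaces of `ℝⁿ`. -/
def Gr (n m : ℕ) : Type :=
  {V : Submodule ℝ (EuclideanSpace ℝ (Fin n)) // Module.finrank ℝ V = m}

/-- The subspace of `ℝⁿ` underlying a point of the Grassmannian. -/
def Gr.plane {n m : ℕ} (V : Gr n m) : Submodule ℝ (EuclideanSpace ℝ (Fin n)) := V.1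

/-- The usual topology of `Gr(n, m)`, given by the distance `‖π_V - π_W‖` (operator norm) of the
orthogonal projections. -/
noncomputable instance Gr.instTopologicalSpace (n m : ℕ) : TopologicalSpace (Gr n m) :=
  TopologicalSpace.induced (fun V : Gr n m => V.plane.starProjection) inferInstance

noncomputable instance Gr.instMeasurableSpace (n m : ℕ) : MeasurableSpace (Gr n m) := borel _

instance Gr.instBorelSpace (n m : ℕ) : BorelSpace (Gr n m) := ⟨rfl⟩

/-- The coordinate plane spanned by the first `m` vectors of the standard basis of `ℝⁿ`. -/
noncomputable def Gr.coord {n m : ℕ} (h : m ≤ n) : Gr n m :=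
  ⟨Submodule.span ℝ (Set.range fun i : Fin m =>
      EuclideanSpace.basisFun (Fin n) ℝ (Fin.castLE h i)), by
    rw [finrank_span_eq_card, Fintype.card_fin]
    exact (EuclideanSpace.basisFun (Fin n) ℝ).orthonormal.linearIndependent.comp _
      (Fin.castLE_injective h)⟩

/-- The action of the orthogonal group on the Grassmannian, `(g, V) ↦ g(V)`. -/
noncomputable def Gr.rotate {n m : ℕ} (g : OrthGroup n) (V : Gr n m) : Gr n m :=
  ⟨V.plane.map (Unitary.linearIsometryEquiv g).toLinearEquiv.toLinearMap,
    ((Unitary.linearIsometryEquiv g).toLinearEquiv.finrank_map_eq V.plane).trans V.2⟩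

/-- The invariant probability measure `γ_{n,m}` on `Gr(n, m)`: the law of `g(V₀)`, where `V₀` is a
fixed `m`-plane and `g` is distributed according to the Haar probability measure of `O(n)`. -/
noncomputable def grMeasure {n m : ℕ} (h : m ≤ n) : Measure (Gr n m) :=
  (Measure.haarMeasure (⊤ : TopologicalSpace.PositiveCompacts (OrthGroup n))).map
    fun g => Gr.rotate g (Gr.coord h)

theorem Gr.continuous_rotate {n m : ℕ} (V : Gr n m) :
    Continuous fun g : OrthGroup n => Gr.rotate g V := by
  refine continuous_induced_rng.mpr ?_
  have : ((fun V : Gr n m => V.plane.starProjection) ∘ fun g : OrthGroup n => Gr.rotate g V) =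
      fun g : OrthGroup n => (g : EuclideanSpace ℝ (Fin n) →L[ℝ] EuclideanSpace ℝ (Fin n)) *
        V.plane.starProjection *
        (star g : EuclideanSpace ℝ (Fin n) →L[ℝ] EuclideanSpace ℝ (Fin n)) := by
    funext g
    ext1 x
    exact Submodule.starProjection_map_apply (Unitary.linearIsometryEquiv g) V.plane x
  rw [this]
  fun_prop

/-- In particular `grMeasure` is the push-forward of a probability measure by a measurable map. -/
instance grMeasure.instIsProbabilityMeasure {n m : ℕ} (h : m ≤ n) :
    IsProbabilityMeasure (grMeasure h) := by
  have : IsProbabilityMeasure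
      (Measure.haarMeasure (⊤ : TopologicalSpace.PositiveCompacts (OrthGroup n))) :=
    ⟨Measure.haarMeasure_self⟩
  exact Measure.isProbabilityMeasure_map (Gr.continuous_rotate _).measurable.aemeasurable

/-! ### Rectifiability -/

/-- A Borel set `R ⊆ ℝⁿ` is countably `m`-rectifiable if it is the union of countably many Lipschitz
images of bounded subsets of `ℝᵐ`. -/
def IsCountablyRectifiable {n : ℕ} (m : ℕ) (R : Set (EuclideanSpace ℝ (Fin n))) : Prop :=
  MeasurableSet R ∧
    ∃ (D : ℕ → Set (EuclideanSpace ℝ (Fin m)))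
      (f : ℕ → EuclideanSpace ℝ (Fin m) → EuclideanSpace ℝ (Fin n)),
      (∀ i, Bornology.IsBounded (D i)) ∧
      (∀ i, ∃ K : ℝ≥0, LipschitzOnWith K (f i) (D i)) ∧
      R = ⋃ i, f i '' D i

/-- A set is purely `m`-unrectifiable if it meets every countably `m`-rectifiable set in an
`ℋ^m`-null set. -/
def IsPurelyUnrectifiable {n : ℕ} (m : ℕ) (A : Set (EuclideanSpace ℝ (Fin n))) : Prop :=
  ∀ R : Set (EuclideanSpace ℝ (Fin n)), IsCountablyRectifiable m R →
    Measure.hausdorffMeasure (m : ℝ) (A ∩ R) = 0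

/-! ### Measures -/

/-- `μ` is concentrated on `A`, i.e. `A` has full `μ`-measure. -/
def IsConcentratedOn {X : Type*} [MeasurableSpace X] (μ : Measure X) (A : Set X) : Prop :=
  μ Aᶜ = 0

/-- A measure is purely atomic if it is concentrated on a countable set of points. -/
def IsPurelyAtomic {X : Type*} [MeasurableSpace X] (μ : Measure X) : Prop :=
  ∃ C : Set X, C.Countable ∧ IsConcentratedOn μ C

/-- `(κ y)` is a disintegration of `μ` with respect to the map `p`: a measurable family of
probability measures, `κ y` being concentrated on the fibre of `p` over `y` for almost every `y`,
such that `μ(B) = ∫ κ y (B) d(pμ)(y)` for every Borel set `B`. -/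
structure IsDisintegration {X Y : Type*} [MeasurableSpace X] [MeasurableSpace Y]
    (μ : Measure X) (p : X → Y) (κ : Kernel Y X) : Prop where
  isProbabilityMeasure : ∀ y, IsProbabilityMeasure (κ y)
  concentrated : ∀ᵐ y ∂(μ.map p), IsConcentratedOn (κ y) (p ⁻¹' {y})
  integral_eq : ∀ B : Set X, MeasurableSet B → μ B = ∫⁻ y, κ y B ∂(μ.map p)

/-- The orthogonal projection `π_V : ℝⁿ → V`. -/
noncomputable def Gr.proj {n m : ℕ} (V : Gr n m) : EuclideanSpace ℝ (Fin n) → V.plane :=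
  fun x => V.plane.orthogonalProjectionOnto x

/-- The conditional measures `μ_{V,y}` of `μ` along `π_V` are purely atomic for `ℋ^m`-a.e. `y ∈ V`.
The family `(μ_{V,y})` is determined only up to a `π_V μ`-null set of `y`, so the condition is that
some version of it has this property. -/
def HasAtomicSlices {n m : ℕ} (μ : Measure (EuclideanSpace ℝ (Fin n))) (V : Gr n m) : Prop :=
  ∃ κ : Kernel V.plane (EuclideanSpace ℝ (Fin n)), IsDisintegration μ V.proj κ ∧
    ∀ᵐ y ∂(Measure.hausdorffMeasure (m : ℝ) : Measure V.plane), IsPurelyAtomic (κ y)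

/-! Planes are traded for linear maps. Up to an isomorphism of the target, a surjective `L : ℝⁿ →
ℝᵐ` is the projection onto `(ker L)ᗮ`, and null sets of planes correspond to Haar-null sets of maps
(`ae_grMeasure_iff`). In the vector space of maps, genericity is tested by Fubini along the
perturbations `L + columnMap i t` of one column. The point `y` lies in the tube of radius `ρ` around
`x + ker (L + columnMap i t)` exactly when `t` is within `ρ / |y i - x i|` of `columnDirection i L x
y`, so measures of tubes become measures of balls in `ℝᵐ`, which can be differentiated.

From 1 to 2: for `L` in a non-null set, `μ` lives on the preimage of a Lebesgue-null set. By
Lindelöf, countably many such `L` suffice for every injective `B : ℝᵐ → ℝⁿ` to have an injective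
composition `L ∘ B` with one of them. The intersection of the corresponding preimages carries `μ`
and has null images under these `L`. It meets a Lipschitz image in a null set, by Rademacher, Sard,
and the choice of an `L` injective on the range of the derivative.

From 2 to 1, singularity: let `f` be the density of `μ.map L`. The density of the part of `μ` in a
set `U` is `κ z U * f z`. Since the punctured cylinders around `x` shrink to the empty set, the thin
tubes at `x`, cut off near `x`, have small density (`IsDisintegration.ae_smallAnnuli`). A Lebesgue
density argument in column space turns this into smallness of whole cones (`ae_column_coneBound`).
If all cones with vertices in a piece of `E` are small, its points without companions in their cone
form a piece of a Lipschitz graph, hence a null set, and around the others a Besicovitch–Federer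
type argument bounds tubes; thus the projected piece has small density (`map_restrict_ball_le`).
Hence `κ z {x} * f z` is arbitrarily small, so no atom of `κ z` is left where `f z ≠ 0`; as the
slices are atomic, `f` vanishes almost everywhere.

From 2 to 1, injectivity: for generic `L` and almost every `x`, the part of `μ` in a slab avoiding
`x` has a projection of finite upper density at `L x`, whereas a singular projection has infinite
upper density at `L y` for almost every `y` in that slab. So `L x ≠ L y`
(`ae_injOn_of_mutuallySingular`). -/

open Set Filter Metric Topology

/-! ### Volumes of balls and differentiation of measures -/

/-- The volume of a ball of radius `ρ` in `ℝᵐ`. -/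
noncomputable def ballVol (m : ℕ) (ρ : ℝ) : ℝ≥0∞ :=
  volume (ball (0 : EuclideanSpace ℝ (Fin m)) ρ)

section BallVol

variable {m : ℕ}

theorem ballVol_eq {ρ : ℝ} (hρ : 0 < ρ) :
    ballVol m ρ = ENNReal.ofReal ρ ^ m * ballVol m 1 := by
  have := Measure.addHaar_ball_of_pos (volume : Measure (EuclideanSpace ℝ (Fin m))) 0 hρ
  rw [finrank_euclideanSpace_fin, ENNReal.ofReal_pow hρ.le] at this
  exact this

theorem volume_ball_eq (z : EuclideanSpace ℝ (Fin m)) (ρ : ℝ) :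
    volume (ball z ρ) = ballVol m ρ :=
  Measure.addHaar_ball_center _ z ρ

theorem volume_closedBall_eq (z : EuclideanSpace ℝ (Fin m)) {ρ : ℝ} (hρ : 0 < ρ) :
    volume (closedBall z ρ) = ballVol m ρ := by
  have := Measure.addHaar_closedBall (volume : Measure (EuclideanSpace ℝ (Fin m))) z hρ.le
  rw [this, ballVol_eq hρ, finrank_euclideanSpace_fin, ENNReal.ofReal_pow hρ.le, ballVol]

theorem ballVol_mul {a ρ : ℝ} (ha : 0 < a) (hρ : 0 < ρ) :
    ballVol m (a * ρ) = ENNReal.ofReal a ^ m * ballVol m ρ := by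
  rw [ballVol_eq (mul_pos ha hρ), ballVol_eq hρ, ENNReal.ofReal_mul ha.le, mul_pow, mul_assoc]

theorem ballVol_mono {ρ ρ' : ℝ} (h : ρ ≤ ρ') : ballVol m ρ ≤ ballVol m ρ' :=
  measure_mono (ball_subset_ball h)

theorem ballVol_pos {ρ : ℝ} (hρ : 0 < ρ) : ballVol m ρ ≠ 0 :=
  (measure_ball_pos _ _ hρ).ne'

theorem ballVol_ne_top (ρ : ℝ) : ballVol m ρ ≠ ∞ := measure_ball_lt_top.ne

theorem continuousOn_ballVol : ContinuousOn (ballVol m) (Ioi 0) := by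
  have : ContinuousOn (fun ρ : ℝ => ENNReal.ofReal ρ ^ m * ballVol m 1) (Ioi 0) := by
    refine Continuous.continuousOn ?_
    exact ENNReal.continuous_mul_const (ballVol_ne_top 1) |>.comp
      ((ENNReal.continuous_pow m).comp ENNReal.continuous_ofReal)
  exact this.congr fun ρ hρ => ballVol_eq hρ

theorem measure_closedBall_le_of_ball_le {α : Measure (EuclideanSpace ℝ (Fin m))} {c : ℝ≥0}
    {t : EuclideanSpace ℝ (Fin m)} {δ : ℝ}
    (h : ∀ ρ, 0 < ρ → ρ < δ → α (ball t ρ) ≤ c * ballVol m ρ) {ρ : ℝ} (hρ : 0 < ρ)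
    (hρδ : ρ < δ) : α (closedBall t ρ) ≤ c * ballVol m ρ := by
  have h1 : Tendsto (fun ρ' => (c : ℝ≥0∞) * ballVol m ρ') (𝓝[>] ρ) (𝓝 (c * ballVol m ρ)) := by
    refine ENNReal.Tendsto.const_mul ?_ (Or.inr ENNReal.coe_ne_top)
    exact ((continuousOn_ballVol.continuousAt (Ioi_mem_nhds hρ)).tendsto).mono_left
      nhdsWithin_le_nhds
  refine ge_of_tendsto h1 ?_
  filter_upwards [Ioo_mem_nhdsGT hρδ] with ρ' hρ'
  exact (measure_mono (closedBall_subset_ball hρ'.1)).trans (h ρ' (hρ.trans hρ'.1) hρ'.2)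

/-- A measure whose upper density on a set is at most `c` is at most `c` times Lebesgue measure
there. -/
theorem measure_le_of_upperDensity_le (α : Measure (EuclideanSpace ℝ (Fin m))) [IsFiniteMeasure α]
    (c : ℝ≥0) (S : Set (EuclideanSpace ℝ (Fin m)))
    (h : ∀ t ∈ S, ∃ δ > 0, ∀ ρ, 0 < ρ → ρ < δ → α (ball t ρ) ≤ c * ballVol m ρ) :
    α S ≤ c * volume S := by
  have : IsLocallyFiniteMeasure (c • (volume : Measure (EuclideanSpace ℝ (Fin m)))) :=
    inferInstance
  have key := (Besicovitch.vitaliFamily α).measure_le_of_frequently_le (ρ := α)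
    (c • (volume : Measure (EuclideanSpace ℝ (Fin m)))) Measure.AbsolutelyContinuous.rfl S ?_
  · simpa using key
  · intro t ht
    obtain ⟨δ, hδ, hb⟩ := h t ht
    refine (Besicovitch.tendsto_filterAt α t).frequently (Eventually.frequently ?_)
    filter_upwards [Ioo_mem_nhdsGT hδ] with ρ hρ
    have := measure_closedBall_le_of_ball_le hb hρ.1 hρ.2
    rwa [← volume_closedBall_eq t hρ.1] at this

theorem measure_le_of_density_lt {α : Measure (EuclideanSpace ℝ (Fin m))} [IsFiniteMeasure α]
    {z : EuclideanSpace ℝ (Fin m)} {d : ℝ≥0∞} {c : ℝ≥0∞}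
    (h : Tendsto (fun r => α (closedBall z r) / volume (closedBall z r)) (𝓝[>] 0) (𝓝 d))
    (hd : d < c) : ∃ k : ℕ, ∀ ρ, 0 < ρ → ρ < 1 / (k + 1 : ℝ) → α (ball z ρ) ≤ c * ballVol m ρ := by
  have h1 := h.eventually (gt_mem_nhds hd)
  rw [eventually_nhdsWithin_iff, Metric.eventually_nhds_iff] at h1
  obtain ⟨ε, hε, h1⟩ := h1
  obtain ⟨k, hk⟩ := exists_nat_one_div_lt hε
  refine ⟨k, fun ρ h0 hρ => ?_⟩
  have h2 := h1 (y := ρ) (by rw [Real.dist_eq, sub_zero, abs_of_pos h0]; linarith) h0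
  rw [volume_closedBall_eq z h0] at h2
  refine (measure_mono ball_subset_closedBall).trans ?_
  rw [ENNReal.div_lt_iff (Or.inl (ballVol_pos h0)) (Or.inl (ballVol_ne_top ρ))] at h2
  exact h2.le

theorem density_le_of_measure_le {α : Measure (EuclideanSpace ℝ (Fin m))} [IsFiniteMeasure α]
    {z : EuclideanSpace ℝ (Fin m)} {d : ℝ≥0∞} {c : ℝ≥0} {δ : ℝ} (hδ : 0 < δ)
    (h : Tendsto (fun r => α (closedBall z r) / volume (closedBall z r)) (𝓝[>] 0) (𝓝 d))
    (hc : ∀ ρ, 0 < ρ → ρ < δ → α (ball z ρ) ≤ c * ballVol m ρ) : d ≤ c := by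
  refine le_of_tendsto h ?_
  filter_upwards [Ioo_mem_nhdsGT hδ] with ρ hρ
  rw [volume_closedBall_eq z hρ.1]
  exact ENNReal.div_le_of_le_mul (measure_closedBall_le_of_ball_le hc hρ.1 hρ.2)

/-- The points at which `α` has finite upper density. -/
def finiteDensitySet (α : Measure (EuclideanSpace ℝ (Fin m))) : Set (EuclideanSpace ℝ (Fin m)) :=
  {z | ∃ M k : ℕ, ∀ ρ : ℝ, 0 < ρ → ρ < 1 / (k + 1 : ℝ) → α (ball z ρ) ≤ M * ballVol m ρ}

theorem ae_mem_finiteDensitySet (α : Measure (EuclideanSpace ℝ (Fin m))) [IsFiniteMeasure α] :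
    ∀ᵐ z, z ∈ finiteDensitySet α := by
  filter_upwards [Besicovitch.ae_tendsto_rnDeriv α volume, α.rnDeriv_lt_top volume] with z hz hlt
  obtain ⟨M, hM⟩ := ENNReal.exists_nat_gt hlt.ne
  obtain ⟨k, hk⟩ := measure_le_of_density_lt hz hM
  exact ⟨M, k, hk⟩

/-- On the piece where the upper density is at most `M`, `α` is at most `M` times volume, and
countably many pieces suffice. Since almost every point has finite density, singularity of `α`
amounts to `α (finiteDensitySet α) = 0`, the form used throughout. -/
theorem measure_eq_zero_of_subset_finiteDensitySet (α : Measure (EuclideanSpace ℝ (Fin m)))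
    [IsFiniteMeasure α] {S : Set (EuclideanSpace ℝ (Fin m))} (hS : S ⊆ finiteDensitySet α)
    (h0 : volume S = 0) : α S = 0 := by
  have : S ⊆ ⋃ M : ℕ, {z ∈ S | ∃ k : ℕ, ∀ ρ : ℝ, 0 < ρ → ρ < 1 / (k + 1 : ℝ) →
      α (ball z ρ) ≤ M * ballVol m ρ} := by
    intro z hz
    obtain ⟨M, k, h⟩ := hS hz
    exact mem_iUnion.2 ⟨M, hz, k, h⟩
  refine measure_mono_null this (measure_iUnion_null fun M => ?_)
  have h1 := measure_le_of_upperDensity_le α M {z ∈ S | ∃ k : ℕ, ∀ ρ : ℝ, 0 < ρ →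
      ρ < 1 / (k + 1 : ℝ) → α (ball z ρ) ≤ M * ballVol m ρ} ?_
  · rw [measure_mono_null (sep_subset _ _) h0, mul_zero] at h1
    exact le_antisymm h1 zero_le
  · rintro t ⟨-, k, hk⟩
    exact ⟨1 / (k + 1 : ℝ), by positivity, by simpa using hk⟩

theorem measure_finiteDensitySet_of_mutuallySingular (α : Measure (EuclideanSpace ℝ (Fin m)))
    [IsFiniteMeasure α] (h : α.MutuallySingular volume) : α (finiteDensitySet α) = 0 := by
  obtain ⟨s, -, hs, hs'⟩ := h
  have h1 := measure_eq_zero_of_subset_finiteDensitySet α (S := finiteDensitySet α ∩ sᶜ)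
    inter_subset_left (measure_mono_null inter_subset_right hs')
  refine measure_mono_null (t := s ∪ finiteDensitySet α ∩ sᶜ) ?_ (measure_union_null hs h1)
  intro x hx
  by_cases h : x ∈ s
  · exact Or.inl h
  · exact Or.inr ⟨hx, h⟩

theorem mutuallySingular_of_measure_finiteDensitySet (α : Measure (EuclideanSpace ℝ (Fin m)))
    [IsFiniteMeasure α] (h : α (finiteDensitySet α) = 0) : α.MutuallySingular volume :=
  ⟨toMeasurable α (finiteDensitySet α), measurableSet_toMeasurable _ _, by rwa [measure_toMeasurable],
    measure_mono_null (compl_subset_compl.2 (subset_toMeasurable _ _)) (ae_mem_finiteDensitySet α)⟩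

/-- A covering argument: if every point of `S` is the centre of a ball in `O` whose fivefold
enlargement has measure controlled by its volume, then `α S` is controlled by the volume of `O`. -/
theorem measure_le_of_forall_closedBall (α : Measure (EuclideanSpace ℝ (Fin m)))
    (c : ℝ≥0∞) (S O : Set (EuclideanSpace ℝ (Fin m))) (r : EuclideanSpace ℝ (Fin m) → ℝ) (R : ℝ)
    (hpos : ∀ u ∈ S, 0 < r u) (hR : ∀ u ∈ S, r u ≤ R) (hO : ∀ u ∈ S, closedBall u (r u) ⊆ O)
    (h : ∀ u ∈ S, α (closedBall u (5 * r u)) ≤ c * ballVol m (r u)) : α S ≤ c * volume O := by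
  obtain ⟨v, hvS, hdisj, hcov⟩ := Vitali.exists_disjoint_subfamily_covering_enlargement_closedBall
    S id r R hR 5 (by norm_num)
  simp only [id] at hdisj hcov
  have hcount : v.Countable :=
    hdisj.countable_of_nonempty_interior fun u hu =>
      (nonempty_ball.2 (hpos u (hvS hu))).mono ball_subset_interior_closedBall
  calc α S ≤ α (⋃ u ∈ v, closedBall u (5 * r u)) := measure_mono fun a ha => by
        obtain ⟨b, hb, hab⟩ := hcov a ha
        exact mem_biUnion hb (hab (mem_closedBall_self (hpos a ha).le))
    _ ≤ ∑' u : v, α (closedBall (u : EuclideanSpace ℝ (Fin m)) (5 * r u)) :=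
        measure_biUnion_le _ hcount _
    _ ≤ ∑' u : v, c * volume (closedBall (u : EuclideanSpace ℝ (Fin m)) (r u)) :=
        ENNReal.tsum_le_tsum fun u => by
          rw [volume_closedBall_eq _ (hpos u (hvS u.2))]; exact h u (hvS u.2)
    _ = c * volume (⋃ u ∈ v, closedBall u (r u)) := by
        rw [ENNReal.tsum_mul_left, measure_biUnion hcount hdisj fun u _ => measurableSet_closedBall]
    _ ≤ c * volume O := by
        gcongr
        exact iUnion₂_subset fun u hu => hO u (hvS hu)

end BallVol

/-- The measure of the sections of an open set is lower semicontinuous. -/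
theorem isClosed_setOf_measure_section_le {A X : Type*} [TopologicalSpace A]
    [FirstCountableTopology A] [TopologicalSpace X] [MeasurableSpace X]
    [OpensMeasurableSpace X] (μ : Measure X) {O : Set (A × X)}
    (hO : IsOpen O) (c : ℝ≥0∞) : IsClosed {a | μ {x | (a, x) ∈ O} ≤ c} := by
  have hsec : ∀ a, MeasurableSet {x | (a, x) ∈ O} := fun a =>
    (hO.preimage (Continuous.prodMk_right a)).measurableSet
  refine IsSeqClosed.isClosed fun u a hu ha => ?_
  have h1 : μ {x | (a, x) ∈ O} ≤
      ∫⁻ x, liminf (fun k => ({x | (u k, x) ∈ O} : Set X).indicator (fun _ => (1 : ℝ≥0∞)) x) atTop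
        ∂μ := by
    rw [← lintegral_indicator_one (hsec a)]
    refine lintegral_mono fun x => ?_
    by_cases hx : (a, x) ∈ O
    swap
    · rw [indicator_of_notMem (show x ∉ {x | (a, x) ∈ O} from hx)]
      exact zero_le
    rw [indicator_of_mem (show x ∈ {x | (a, x) ∈ O} from hx)]
    have : ∀ᶠ k in atTop, (u k, x) ∈ O :=
      (ha.prodMk_nhds tendsto_const_nhds).eventually (hO.mem_nhds hx)
    refine le_liminf_of_le (by isBoundedDefault) ?_
    filter_upwards [this] with k hk
    rw [indicator_of_mem (show x ∈ {x | (u k, x) ∈ O} from hk)]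
    rfl
  refine h1.trans ((lintegral_liminf_le fun k => measurable_const.indicator (hsec _)).trans ?_)
  refine liminf_le_of_frequently_le' (Eventually.frequently (Eventually.of_forall fun k => ?_))
  rw [lintegral_indicator_const (hsec _), one_mul]
  exact hu k

/-! ### Linear maps and their tubes -/

/-- The space `ℝᵏ`. -/
abbrev Euc (k : ℕ) : Type := EuclideanSpace ℝ (Fin k)

section Tubes

variable {n m : ℕ}

/-- The linear map whose only nonzero column is the `i`-th one, equal to `t`. -/
noncomputable def columnMap (i : Fin n) : Euc m →ₗ[ℝ] (Euc n →L[ℝ] Euc m) where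
  toFun t := (EuclideanSpace.proj i : Euc n →L[ℝ] ℝ).smulRight t
  map_add' s t := by ext1 y; simp
  map_smul' c t := by ext1 y; exact smul_comm (y i) c t

@[simp] theorem columnMap_apply (i : Fin n) (t : Euc m) (y : Euc n) :
    columnMap i t y = y i • t := rfl

theorem continuous_columnMap (i : Fin n) :
    Continuous (columnMap i : Euc m →ₗ[ℝ] (Euc n →L[ℝ] Euc m)) :=
  LinearMap.continuous_of_finiteDimensional _

/-- A Haar measure on the space of linear maps `ℝⁿ → ℝᵐ`. -/
noncomputable abbrev clmHaar (n m : ℕ) : Measure (Euc n →L[ℝ] Euc m) := Measure.addHaar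

/-- Fubini and translation invariance of Haar measure: a measurable property is generic as soon as
it is generic on every translate of the space of `i`-th columns. -/
theorem ae_of_forall_ae_add_columnMap (i : Fin n) {P : Set (Euc n →L[ℝ] Euc m)}
    (hP : MeasurableSet P) (h : ∀ L, ∀ᵐ t : Euc m, L + columnMap i t ∈ P) :
    ∀ᵐ (L : Euc n →L[ℝ] Euc m) ∂(clmHaar n m), L ∈ P :=
  ae_mem_of_ae_add_linearMap_mem (columnMap i) volume Measure.addHaar hP h

theorem measurable_clm (L : Euc n →L[ℝ] Euc m) : Measurable L := L.continuous.measurable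

theorem map_restrict_ball (μ : Measure (Euc n)) (U : Set (Euc n))
    (L : Euc n →L[ℝ] Euc m) (x : Euc n) (ρ : ℝ) :
    (μ.restrict U).map L (ball (L x) ρ) = μ {y | y ∈ U ∧ ‖L (y - x)‖ < ρ} := by
  rw [Measure.map_apply (measurable_clm L) measurableSet_ball,
    Measure.restrict_apply (measurable_clm L measurableSet_ball)]
  congr 1
  ext y
  simp [dist_eq_norm, and_comm]

/-- The strict inequalities make the tube an open condition on `(x, L, y)`, so its measure is lower
semicontinuous in `(x, L)`. The resulting joint measurability permits exchanging "almost every `x`"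
and "almost every `L`". -/
theorem isClosed_tube (μ : Measure (Euc n)) {W : Set (Euc n × Euc n)} (hW : IsOpen W)
    (ρ : ℝ) (c : ℝ≥0∞) : IsClosed {p : Euc n × (Euc n →L[ℝ] Euc m) |
      μ {y | (p.1, y) ∈ W ∧ ‖p.2 (y - p.1)‖ < ρ} ≤ c} := by
  have hO : IsOpen {q : (Euc n × (Euc n →L[ℝ] Euc m)) × Euc n |
      (q.1.1, q.2) ∈ W ∧ ‖q.1.2 (q.2 - q.1.1)‖ < ρ} := by
    have h1 : IsOpen {q : (Euc n × (Euc n →L[ℝ] Euc m)) × Euc n | (q.1.1, q.2) ∈ W} :=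
      hW.preimage (by fun_prop)
    exact h1.and (isOpen_lt (by fun_prop) continuous_const)
  exact isClosed_setOf_measure_section_le μ hO c

theorem isClosed_forall_tube (μ : Measure (Euc n)) {W : Set (Euc n × Euc n)} (hW : IsOpen W)
    (c : ℝ≥0∞) (δ : ℝ) : IsClosed {p : Euc n × (Euc n →L[ℝ] Euc m) | ∀ ρ, 0 < ρ → ρ < δ →
      μ {y | (p.1, y) ∈ W ∧ ‖p.2 (y - p.1)‖ < ρ} ≤ c * ballVol m ρ} := by
  simp only [ofPred_forall]
  exact isClosed_iInter fun ρ => isClosed_iInter fun _ => isClosed_iInter fun _ =>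
    isClosed_tube μ hW ρ _

theorem mem_finiteDensitySet_map_restrict (μ : Measure (Euc n)) (U : Set (Euc n))
    (L : Euc n →L[ℝ] Euc m) (x : Euc n) :
    L x ∈ finiteDensitySet ((μ.restrict U).map L) ↔ ∃ M k : ℕ, ∀ ρ, 0 < ρ → ρ < 1 / (k + 1 : ℝ) →
      μ {y | y ∈ U ∧ ‖L (y - x)‖ < ρ} ≤ M * ballVol m ρ := by
  simp only [finiteDensitySet, map_restrict_ball, mem_ofPred_eq]

theorem measurableSet_mem_finiteDensitySet (μ : Measure (Euc n)) {U : Set (Euc n)}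
    (hU : IsOpen U) : MeasurableSet {p : Euc n × (Euc n →L[ℝ] Euc m) |
      p.2 p.1 ∈ finiteDensitySet ((μ.restrict U).map p.2)} := by
  simp only [mem_finiteDensitySet_map_restrict, ofPred_exists]
  refine MeasurableSet.iUnion fun M => MeasurableSet.iUnion fun k => ?_
  exact (isClosed_forall_tube μ (hU.preimage continuous_snd) M (1 / (k + 1 : ℝ))).measurableSet

/-- The open slab between two values of the `i`-th coordinate. -/
def slab (i : Fin n) (a b : ℝ) : Set (Euc n) := {y | a < y i ∧ y i < b}

theorem isOpen_slab (i : Fin n) (a b : ℝ) : IsOpen (slab i a b) :=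
  IsOpen.and (isOpen_lt continuous_const (by fun_prop : Continuous fun y : Euc n => y i))
    (isOpen_lt (by fun_prop : Continuous fun y : Euc n => y i) continuous_const)

/-- For `y i ≠ x i`, the unique column `t` such that `L + columnMap i t` takes the same value at
`x` and at `y`. -/
noncomputable def columnDirection (i : Fin n) (L : Euc n →L[ℝ] Euc m) (x y : Euc n) : Euc m :=
  -((y i - x i)⁻¹ • L (y - x))

theorem measurable_columnDirection (i : Fin n) (L : Euc n →L[ℝ] Euc m) (x : Euc n) :
    Measurable (columnDirection i L x) := by
  unfold columnDirection
  have h1 : Measurable fun y : Euc n => (y i - x i)⁻¹ :=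
    Measurable.inv (by fun_prop : Continuous fun y : Euc n => y i - x i).measurable
  have h2 : Measurable fun y : Euc n => L (y - x) :=
    (by fun_prop : Continuous fun y : Euc n => L (y - x)).measurable
  exact (h1.smul h2).neg

theorem norm_add_columnMap_apply (i : Fin n) (L : Euc n →L[ℝ] Euc m) {x y : Euc n}
    (h : y i ≠ x i) (t : Euc m) : ‖(L + columnMap i t) (y - x)‖ =
      |y i - x i| * dist (columnDirection i L x y) t := by
  have h' : y i - x i ≠ 0 := sub_ne_zero.2 h
  have : (L + columnMap i t) (y - x) = -((y i - x i) • (columnDirection i L x y - t)) := by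
    rw [columnDirection, smul_sub, smul_neg, smul_smul, mul_inv_cancel₀ h', one_smul]
    simp only [_root_.add_apply, columnMap_apply, PiLp.sub_apply]
    abel
  rw [this, norm_neg, norm_smul, dist_eq_norm, Real.norm_eq_abs]

/-- Away from `x`, almost every tube through `x` has finite density. -/
theorem ae_mem_finiteDensitySet_slab (μ : Measure (Euc n)) [IsFiniteMeasure μ] (x : Euc n)
    (i : Fin n) {a b : ℝ} (hx : x i ∉ Icc a b) :
    ∀ᵐ (L : Euc n →L[ℝ] Euc m) ∂(clmHaar n m),
      L x ∈ finiteDensitySet ((μ.restrict (slab i a b)).map L) := by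
  obtain ⟨d, hd, hdist⟩ : ∃ d > 0, ∀ y ∈ slab i a b, d ≤ |y i - x i| := by
    rw [mem_Icc, not_and_or, not_le, not_le] at hx
    rcases hx with hx | hx
    · exact ⟨a - x i, by linarith, fun y hy => le_trans (by linarith [hy.1]) (le_abs_self _)⟩
    · exact ⟨x i - b, by linarith, fun y hy => le_trans (by linarith [hy.2]) (neg_le_abs _)⟩
  refine ae_of_forall_ae_add_columnMap i (P := {L | L x ∈ finiteDensitySet
    ((μ.restrict (slab i a b)).map L)}) ?_ fun L => ?_
  · exact (measurableSet_mem_finiteDensitySet μ (isOpen_slab i a b)).preimage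
      (by fun_prop : Measurable fun L : Euc n →L[ℝ] Euc m => (x, L))
  · filter_upwards [ae_mem_finiteDensitySet
      ((μ.restrict (slab i a b)).map (columnDirection i L x))] with t ht
    obtain ⟨M, k, ht⟩ := ht
    rw [mem_finiteDensitySet_map_restrict]
    -- As `|y i - x i| ≥ d` on the slab, a point of the tube of radius `ρ` has its direction within
    -- `d⁻¹ * ρ` of `t`; the density bound is multiplied by `d⁻¹ ^ m`.
    obtain ⟨M', hM'⟩ := exists_nat_ge (M * ENNReal.toReal (ENNReal.ofReal d⁻¹ ^ m))
    obtain ⟨k', hk'⟩ := exists_nat_one_div_lt (show 0 < d / (k + 1 : ℝ) by positivity)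
    refine ⟨M', k', fun ρ h0 hρ => ?_⟩
    have h1 := ht (d⁻¹ * ρ) (by positivity) (by
      rw [inv_mul_lt_iff₀ hd]; calc ρ < _ := hρ
        _ < _ := hk'
        _ = _ := by ring)
    rw [Measure.map_apply (measurable_columnDirection i L x) measurableSet_ball,
      Measure.restrict_apply (measurable_columnDirection i L x measurableSet_ball),
      ballVol_mul (inv_pos.2 hd) h0, ← mul_assoc] at h1
    refine (measure_mono ?_).trans (h1.trans ?_)
    · rintro y ⟨hy, hyρ⟩
      have hne : y i ≠ x i := by
        intro h; have := hdist y hy; rw [h, sub_self, abs_zero] at this; linarith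
      refine ⟨?_, hy⟩
      rw [norm_add_columnMap_apply i L hne] at hyρ
      rw [mem_preimage, mem_ball, lt_inv_mul_iff₀ hd]
      exact (mul_le_mul_of_nonneg_right (hdist y hy) dist_nonneg).trans_lt hyρ
    · gcongr
      rw [← ENNReal.ofReal_toReal (a := ENNReal.ofReal d⁻¹ ^ m) (by finiteness),
        ← ENNReal.ofReal_natCast, ← ENNReal.ofReal_mul (by positivity), ← ENNReal.ofReal_natCast]
      exact ENNReal.ofReal_le_ofReal hM'

/-- A singular projection is injective on a set of full measure, for almost every linear map. -/
theorem ae_injOn_of_mutuallySingular (m : ℕ) (μ : Measure (Euc n)) [IsFiniteMeasure μ] :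
    ∀ᵐ (L : Euc n →L[ℝ] Euc m) ∂(clmHaar n m),
      (μ.map L).MutuallySingular volume → ∃ A, IsConcentratedOn μ A ∧ InjOn L A := by
  have key : ∀ᵐ (L : Euc n →L[ℝ] Euc m) ∂(clmHaar n m), ∀ᵐ x ∂μ,
      ∀ (i : Fin n) (a b : ℚ), x i ∉ Icc (a : ℝ) b →
        L x ∈ finiteDensitySet ((μ.restrict (slab i a b)).map L) := by
    have : ∀ᵐ x ∂μ, ∀ᵐ (L : Euc n →L[ℝ] Euc m) ∂(clmHaar n m),
        ∀ (i : Fin n) (a b : ℚ), x i ∉ Icc (a : ℝ) b →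
          L x ∈ finiteDensitySet ((μ.restrict (slab i a b)).map L) := by
      refine Eventually.of_forall fun x => ?_
      simp only [ae_all_iff]
      exact fun i a b hx => ae_mem_finiteDensitySet_slab μ x i hx
    refine (Measure.ae_ae_comm ?_).1 this
    simp only [ofPred_forall]
    refine MeasurableSet.iInter fun i => MeasurableSet.iInter fun a => MeasurableSet.iInter fun b =>
      ?_
    refine MeasurableSet.imp (p := fun q : Euc n × (Euc n →L[ℝ] Euc m) => q.1 i ∉ Icc (a : ℝ) b)
      ?_ (measurableSet_mem_finiteDensitySet μ (isOpen_slab i a b))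
    exact (measurableSet_Icc.preimage
      (by fun_prop : Measurable fun q : Euc n × (Euc n →L[ℝ] Euc m) => q.1 i)).compl
  filter_upwards [key] with L hL hsing
  -- The projection of each slab is also singular, hence has infinite upper density at almost all of
  -- its own points.
  have h2 : ∀ᵐ x ∂μ, ∀ (i : Fin n) (a b : ℚ), x ∈ slab i (a : ℝ) b →
      L x ∉ finiteDensitySet ((μ.restrict (slab i a b)).map L) := by
    simp only [ae_all_iff]
    intro i a b
    have hs : ((μ.restrict (slab i a b)).map L).MutuallySingular volume :=
      hsing.mono_ac (Measure.AbsolutelyContinuous.map Measure.restrict_le_self.absolutelyContinuous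
        (measurable_clm L)) Measure.AbsolutelyContinuous.rfl
    have h0 := measure_finiteDensitySet_of_mutuallySingular _ hs
    have h1 : ∀ᵐ z ∂((μ.restrict (slab i a b)).map L),
        z ∉ finiteDensitySet ((μ.restrict (slab i a b)).map L) := measure_eq_zero_iff_ae_notMem.1 h0
    have h3 := ae_of_ae_map (measurable_clm L).aemeasurable h1
    exact (ae_restrict_iff' (isOpen_slab i _ _).measurableSet).1 h3
  refine ⟨{x | (∀ (i : Fin n) (a b : ℚ), x i ∉ Icc (a : ℝ) b →
        L x ∈ finiteDensitySet ((μ.restrict (slab i a b)).map L)) ∧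
      ∀ (i : Fin n) (a b : ℚ), x ∈ slab i (a : ℝ) b →
        L x ∉ finiteDensitySet ((μ.restrict (slab i a b)).map L)}, hL.and h2, ?_⟩
  rintro x hx y hy hxy
  by_contra hne
  obtain ⟨i, hi⟩ : ∃ i, x i ≠ y i := by
    by_contra! h
    exact hne (PiLp.ext h)
  -- A rational slab of half-width at most `ε` around `y` excludes `x`. Its projection would have
  -- both finite and infinite upper density at `L x = L y`.
  obtain ⟨ε, hε, hεi⟩ : ∃ ε : ℝ, 0 < ε ∧ ε < |x i - y i| := exists_between (abs_pos.2 (sub_ne_zero.2 hi))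
  obtain ⟨a, ha1, ha2⟩ := exists_rat_btwn (show y i - ε < y i by linarith)
  obtain ⟨b, hb1, hb2⟩ := exists_rat_btwn (show y i < y i + ε by linarith)
  refine hy.2 i a b ⟨ha2, hb1⟩ (hxy ▸ hx.1 i a b fun h => ?_)
  have : |x i - y i| ≤ ε := abs_le.2 ⟨by linarith [h.1], by linarith [h.2]⟩
  linarith

end Tubes

/-! ### Measure of cones at a fixed vertex -/

section Cones

variable {n m : ℕ}

/-- The points whose `i`-th coordinate is at distance between `δ` and `r` from that of `x`. -/
def annulus (i : Fin n) (x : Euc n) (δ r : ℝ) : Set (Euc n) :=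
  {y | δ < |y i - x i| ∧ |y i - x i| < r}

/-- The tubes around `x + ker L` have small density outside of any neighbourhood of `x`. -/
def SmallAnnuli (μ : Measure (Euc n)) (i : Fin n) (ε : ℝ≥0) (x : Euc n)
    (L : Euc n →L[ℝ] Euc m) : Prop :=
  ∃ J : ℕ, ∀ δ r : ℚ, 0 < δ → (r : ℝ) < 1 / (J + 1 : ℝ) → ∃ k : ℕ, ∀ ρ, 0 < ρ →
    ρ < 1 / (k + 1 : ℝ) → μ {y | y ∈ annulus i x δ r ∧ ‖L (y - x)‖ < ρ} ≤ ε * ballVol m ρ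

/-- The cones with vertex `x` around `x + ker L` have small measure. -/
def ConeBound (μ : Measure (Euc n)) (i : Fin n) (ε : ℝ≥0) (η : ℝ) (x : Euc n)
    (L : Euc n →L[ℝ] Euc m) : Prop :=
  ∀ r s : ℝ, 0 < r → r < η → 0 < s → s < η →
    μ {y | |y i - x i| < r ∧ ‖L (y - x)‖ < s * |y i - x i|} ≤ ε * ballVol m (r * s)

theorem isOpen_annulus (i : Fin n) (δ r : ℝ) :
    IsOpen {p : Euc n × Euc n | p.2 ∈ annulus i p.1 δ r} :=
  IsOpen.and
    (isOpen_lt continuous_const (by fun_prop : Continuous fun p : Euc n × Euc n => |p.2 i - p.1 i|))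
    (isOpen_lt (by fun_prop : Continuous fun p : Euc n × Euc n => |p.2 i - p.1 i|) continuous_const)

theorem measurableSet_smallAnnuli (μ : Measure (Euc n)) (i : Fin n) (ε : ℝ≥0) :
    MeasurableSet {p : Euc n × (Euc n →L[ℝ] Euc m) | SmallAnnuli μ i ε p.1 p.2} := by
  simp only [SmallAnnuli, ofPred_exists, ofPred_forall]
  refine MeasurableSet.iUnion fun J => MeasurableSet.iInter fun δ => MeasurableSet.iInter fun r =>
    MeasurableSet.iInter fun _ => MeasurableSet.iInter fun _ => MeasurableSet.iUnion fun k => ?_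
  have := (isClosed_forall_tube (m := m) μ (isOpen_annulus i δ r) ε (1 / (k + 1 : ℝ))).measurableSet
  simp only [ofPred_forall] at this
  exact this

theorem isClosed_coneBound (μ : Measure (Euc n)) (i : Fin n) (ε : ℝ≥0) (η : ℝ) :
    IsClosed {p : Euc n × (Euc n →L[ℝ] Euc m) | ConeBound μ i ε η p.1 p.2} := by
  simp only [ConeBound, ofPred_forall]
  refine isClosed_iInter fun r => isClosed_iInter fun s => isClosed_iInter fun _ =>
    isClosed_iInter fun _ => isClosed_iInter fun _ => isClosed_iInter fun _ => ?_
  refine isClosed_setOf_measure_section_le μ (O := {q : (Euc n × (Euc n →L[ℝ] Euc m)) × Euc n |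
    |q.2 i - q.1.1 i| < r ∧ ‖q.1.2 (q.2 - q.1.1)‖ < s * |q.2 i - q.1.1 i|}) ?_ _
  exact IsOpen.and (isOpen_lt (by fun_prop) continuous_const) (isOpen_lt (by fun_prop) (by fun_prop))

theorem ae_density_point {C : Set (Euc m)} (hC : MeasurableSet C) :
    ∀ᵐ t, t ∈ C → ∀ η : ℝ≥0∞, 0 < η → ∃ δ > 0, ∀ s, 0 < s → s < δ →
      volume (closedBall t s \ C) ≤ η * ballVol m s := by
  filter_upwards [Besicovitch.ae_tendsto_measure_inter_div_of_measurableSet volume hC.compl]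
    with t ht htC η hη
  rw [indicator_of_notMem (not_not.2 htC)] at ht
  have h1 := ht.eventually (gt_mem_nhds hη)
  rw [eventually_nhdsWithin_iff, Metric.eventually_nhds_iff] at h1
  obtain ⟨δ, hδ, h1⟩ := h1
  refine ⟨δ, hδ, fun s h0 hs => ?_⟩
  have h2 := h1 (y := s) (by rwa [Real.dist_eq, sub_zero, abs_of_pos h0]) h0
  rw [volume_closedBall_eq t h0,
    ENNReal.div_lt_iff (Or.inl (ballVol_pos h0)) (Or.inl (ballVol_ne_top s))] at h2
  rw [sdiff_eq, inter_comm]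
  exact h2.le

/-! ### Tubes and cones at a point, seen in the space of columns. -/

section ColumnMeasure

variable (μ : Measure (Euc n)) (i : Fin n) (L : Euc n →L[ℝ] Euc m) (x : Euc n)

/-- The distribution of the columns in whose direction the points of a cylinder around `x` are
seen from `x`. -/
noncomputable def columnMeasure (r : ℝ) : Measure (Euc m) :=
  (μ.restrict {y | y i ≠ x i ∧ |y i - x i| < r}).map (columnDirection i L x)

instance columnMeasure.instIsFiniteMeasure [IsFiniteMeasure μ] (r : ℝ) :
    IsFiniteMeasure (columnMeasure μ i L x r) := by
  unfold columnMeasure; infer_instance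

variable {μ i L x}

theorem columnMeasure_apply (r : ℝ) {S : Set (Euc m)} (hS : MeasurableSet S) :
    columnMeasure μ i L x r S =
      μ (columnDirection i L x ⁻¹' S ∩ {y | y i ≠ x i ∧ |y i - x i| < r}) := by
  rw [columnMeasure, Measure.map_apply (measurable_columnDirection i L x) hS,
    Measure.restrict_apply (measurable_columnDirection i L x hS)]

/-- The punctured cylinder is exhausted by annuli of inner width `1 / (N + 1)`. The scale at which
the tube bound starts depends on `N`, but the resulting comparison with volume does not, so it
survives the monotone limit. -/
theorem columnMeasure_le_of_smallAnnuli [IsFiniteMeasure μ] {ε : ℝ≥0} {J : ℕ} {S : Set (Euc m)}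
    (hS : MeasurableSet S)
    (h : ∀ t ∈ S, ∀ δ r : ℚ, 0 < δ → (r : ℝ) < 1 / (J + 1 : ℝ) → ∃ k : ℕ, ∀ ρ, 0 < ρ →
      ρ < 1 / (k + 1 : ℝ) → μ {y | y ∈ annulus i x δ r ∧ ‖(L + columnMap i t) (y - x)‖ < ρ} ≤
        ε * ballVol m ρ) {r : ℝ} (hr : 0 < r) (hrJ : 2 * r < 1 / (J + 1 : ℝ)) :
    columnMeasure μ i L x r S ≤ ε * ENNReal.ofReal (2 * r) ^ m * volume S := by
  -- `SmallAnnuli` speaks of rational radii only; rounding `r` up costs the factor 2.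
  obtain ⟨r', hr1, hr2⟩ := exists_rat_btwn (show r < 2 * r by linarith)
  have hr0 : (0 : ℝ) < r' := hr.trans hr1
  set A : ℕ → Set (Euc n) := fun N => annulus i x ((1 / (N + 1 : ℚ) : ℚ) : ℝ) r' with hA
  have hAm : ∀ N, MeasurableSet (A N) := fun N =>
    ((isOpen_annulus i _ _).preimage (Continuous.prodMk_right x)).measurableSet
  have hmono : Monotone fun N => columnDirection i L x ⁻¹' S ∩ A N := by
    intro N N' hN y hy
    refine ⟨hy.1, lt_of_le_of_lt ?_ hy.2.1, hy.2.2⟩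
    push_cast
    exact one_div_le_one_div_of_le (by positivity) (by exact_mod_cast Nat.succ_le_succ hN)
  have hsub : columnDirection i L x ⁻¹' S ∩ {y | y i ≠ x i ∧ |y i - x i| < r} ⊆
      ⋃ N, columnDirection i L x ⁻¹' S ∩ A N := by
    rintro y ⟨hy, hne, hyr⟩
    obtain ⟨N, hN⟩ := exists_nat_one_div_lt (abs_pos.2 (sub_ne_zero.2 hne))
    exact mem_iUnion.2 ⟨N, hy, by push_cast; exact hN, hyr.trans hr1⟩
  rw [columnMeasure_apply r hS]
  refine (measure_mono hsub).trans ?_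
  rw [hmono.measure_iUnion]
  refine iSup_le fun N => ?_
  have h1 := measure_le_of_upperDensity_le ((μ.restrict (A N)).map (columnDirection i L x))
    (ε * Real.toNNReal r' ^ m) S fun t ht => ?_
  · rw [Measure.map_apply (measurable_columnDirection i L x) hS, Measure.restrict_apply
      (measurable_columnDirection i L x hS)] at h1
    refine h1.trans ?_
    gcongr
    push_cast
    gcongr
    exact ENNReal.ofReal_le_ofReal hr2.le
  · obtain ⟨k, hk⟩ := h t ht (1 / (N + 1 : ℚ)) r' (by positivity) (hr2.trans hrJ)
    refine ⟨1 / (k + 1 : ℝ) / r', by positivity, fun s h0 hs => ?_⟩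
    have h2 := hk (r' * s) (by positivity) (by rwa [lt_div_iff₀' hr0] at hs)
    rw [ballVol_mul hr0 h0, ← mul_assoc] at h2
    rw [Measure.map_apply (measurable_columnDirection i L x) measurableSet_ball,
      Measure.restrict_apply (measurable_columnDirection i L x measurableSet_ball)]
    refine (measure_mono ?_).trans (h2.trans_eq (by push_cast; rfl))
    rintro y ⟨hy, hyA⟩
    refine ⟨hyA, ?_⟩
    have hpos : 0 < |y i - x i| := lt_trans (by positivity) hyA.1
    rw [norm_add_columnMap_apply i L (sub_ne_zero.1 (abs_pos.1 hpos))]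
    have h3 : dist (columnDirection i L x y) t < s := hy
    nlinarith [hyA.2, dist_nonneg (x := columnDirection i L x y) (y := t)]

theorem columnMeasure_ball_le {M : ℝ≥0∞} {k : ℕ} {t : Euc m}
    (h : ∀ ρ, 0 < ρ → ρ < 1 / (k + 1 : ℝ) →
      μ {y | ‖(L + columnMap i t) (y - x)‖ < ρ} ≤ M * ballVol m ρ)
    {r s : ℝ} (hr : 0 < r) (hs : 0 < s) (hrs : r * s < 1 / (k + 1 : ℝ)) :
    columnMeasure μ i L x r (ball t s) ≤ M * ballVol m (r * s) := by
  rw [columnMeasure_apply r measurableSet_ball]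
  refine (measure_mono ?_).trans (h (r * s) (by positivity) hrs)
  rintro y ⟨hy, hne, hyr⟩
  have h3 : dist (columnDirection i L x y) t < s := hy
  rw [mem_ofPred_eq, norm_add_columnMap_apply i L hne]
  have hpos := abs_pos.2 (sub_ne_zero.2 hne)
  nlinarith [dist_nonneg (x := columnDirection i L x y) (y := t)]

/-- A Whitney-type covering: outside `C` nothing is known about the tubes, but a ball around `u ∉ C`
of radius comparable to `infDist u C` lies in a comparable ball centred in `C`, where the bound
holds. The half-distance balls themselves avoid `C`, so their total volume is that of a subset of
the complement. -/
theorem columnMeasure_diff_le {M : ℝ≥0∞} {k : ℕ} {C : Set (Euc m)} (hC : IsClosed C)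
    (h : ∀ t ∈ C, ∀ ρ, 0 < ρ → ρ < 1 / (k + 1 : ℝ) →
      μ {y | ‖(L + columnMap i t) (y - x)‖ < ρ} ≤ M * ballVol m ρ) {t : Euc m} (ht : t ∈ C)
    {r s : ℝ} (hr : 0 < r) (hr1 : r < 1) (hs : 0 < s) (hsk : 4 * s < 1 / (k + 1 : ℝ)) :
    columnMeasure μ i L x r (ball t s \ C) ≤
      M * ENNReal.ofReal (8 * r) ^ m * volume (closedBall t (2 * s) \ C) := by
  have hne : C.Nonempty := ⟨t, ht⟩
  have hd : ∀ u ∈ ball t s \ C, 0 < infDist u C := fun u hu =>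
    (hC.notMem_iff_infDist_pos hne).1 hu.2
  have hds : ∀ u ∈ ball t s \ C, infDist u C < s := fun u hu =>
    (infDist_le_dist_of_mem ht).trans_lt hu.1
  refine measure_le_of_forall_closedBall _ _ _ _ (fun u => infDist u C / 2) s
    (fun u hu => half_pos (hd u hu)) (fun u hu => by linarith [hd u hu, hds u hu]) ?_ ?_
  · intro u hu w hw
    rw [mem_closedBall] at hw
    refine ⟨?_, fun hwC => ?_⟩
    · rw [mem_closedBall]
      have h1 : dist u t < s := hu.1
      linarith [dist_triangle w u t, hds u hu]
    · have := infDist_le_dist_of_mem (x := u) hwC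
      rw [dist_comm] at this
      linarith [hd u hu]
  · intro u hu
    have hd0 := hd u hu
    -- The fivefold enlargement has radius `5 / 2 * infDist u C`; adding `3 / 2` gives 4, which is 8
    -- times the radius of the original ball.
    obtain ⟨c, hc, hcu⟩ := (infDist_lt_iff hne).1 (show infDist u C < 3 / 2 * infDist u C by linarith)
    have hsub : closedBall u (5 * (infDist u C / 2)) ⊆ ball c (4 * infDist u C) := by
      intro w hw
      rw [mem_closedBall] at hw
      rw [mem_ball]
      linarith [dist_triangle w u c]
    refine (measure_mono hsub).trans ((columnMeasure_ball_le (h c hc) hr (by positivity) ?_).trans ?_)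
    · have := hds u hu
      nlinarith
    · rw [mul_assoc, ← ballVol_mul (by positivity) (by positivity)]
      gcongr
      exact (congrArg _ (by ring)).le

end ColumnMeasure

/-- A cone of aperture `s` is seen in column space as the ball of radius `s` around `t`. Almost
every `t` satisfying the hypotheses is a density point of the set of columns satisfying them with
the same constants, so in small balls only a small proportion of columns is bad. -/
theorem ae_column_coneBound (μ : Measure (Euc n)) [IsFiniteMeasure μ] (x : Euc n)
    (i : Fin n) {ε : ℝ≥0} (hε : 0 < ε) (L : Euc n →L[ℝ] Euc m) : ∀ᵐ t : Euc m,
      (L + columnMap i t) x ∈ finiteDensitySet (μ.map (L + columnMap i t)) →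
      SmallAnnuli μ i ε x (L + columnMap i t) →
      ∃ k : ℕ, ConeBound μ i (2 ^ (m + 1) * ε) (1 / (k + 1 : ℝ)) x (L + columnMap i t) := by
  set C₁ : ℕ → ℕ → Set (Euc m) := fun M k => {t | ∀ ρ, 0 < ρ → ρ < 1 / (k + 1 : ℝ) →
      μ {y | ‖(L + columnMap i t) (y - x)‖ < ρ} ≤ M * ballVol m ρ} with hC₁
  set C₂ : ℕ → Set (Euc m) := fun J => {t | ∀ δ r : ℚ, 0 < δ → (r : ℝ) < 1 / (J + 1 : ℝ) →
      ∃ k : ℕ, ∀ ρ, 0 < ρ → ρ < 1 / (k + 1 : ℝ) →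
        μ {y | y ∈ annulus i x δ r ∧ ‖(L + columnMap i t) (y - x)‖ < ρ} ≤ ε * ballVol m ρ} with hC₂
  have hcont : Continuous fun t : Euc m => (x, L + columnMap i t) :=
    continuous_const.prodMk (continuous_const.add (continuous_columnMap i))
  have hC₁c : ∀ M k, IsClosed (C₁ M k) := by
    intro M k
    have := (isClosed_forall_tube (m := m) μ (W := univ) isOpen_univ M (1 / (k + 1 : ℝ))).preimage
      hcont
    convert! this using 1
    ext t
    simp only [hC₁, mem_preimage, mem_ofPred_eq, mem_univ, true_and]
  have hC₂m : ∀ J, MeasurableSet (C₂ J) := by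
    intro J
    simp only [hC₂, ofPred_exists, ofPred_forall]
    refine MeasurableSet.iInter fun δ => MeasurableSet.iInter fun r =>
      MeasurableSet.iInter fun _ => MeasurableSet.iInter fun _ => MeasurableSet.iUnion fun k => ?_
    have := ((isClosed_forall_tube (m := m) μ (isOpen_annulus i δ r) ε
      (1 / (k + 1 : ℝ))).preimage hcont).measurableSet
    simp only [ofPred_forall, preimage_iInter] at this
    exact this
  have hdens : ∀ᵐ t : Euc m, ∀ M k J, t ∈ C₁ M k ∩ C₂ J → ∀ η : ℝ≥0∞, 0 < η → ∃ δ > 0, ∀ s, 0 < s →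
      s < δ → volume (closedBall t s \ (C₁ M k ∩ C₂ J)) ≤ η * ballVol m s := by
    simp only [ae_all_iff]
    exact fun M k J => ae_density_point ((hC₁c M k).measurableSet.inter (hC₂m J))
  filter_upwards [hdens] with t ht hFD hSA
  obtain ⟨M, k, h1⟩ : ∃ M k, t ∈ C₁ M k := by
    have := (mem_finiteDensitySet_map_restrict μ univ (L + columnMap i t) x).1
      (by rwa [Measure.restrict_univ])
    simpa [hC₁] using this
  obtain ⟨J, h2⟩ : ∃ J, t ∈ C₂ J := hSA
  -- The two error terms `e5` and `e6` together must not exceed the main term. If `M = 0`, then `η =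
  -- ∞` and the product is still `0`.
  obtain ⟨η, hη0, hη⟩ : ∃ η : ℝ≥0∞, 0 < η ∧ 2 * M * 8 ^ m * η ≤ ε := by
    refine ⟨ε / (2 * M * 8 ^ m), ENNReal.div_pos (by simpa using hε.ne') (by finiteness), ?_⟩
    exact ENNReal.mul_div_le
  obtain ⟨δ, hδ, hvol⟩ := ht M k J ⟨h1, h2⟩ η hη0
  obtain ⟨N, hN⟩ := exists_nat_one_div_lt (show (0 : ℝ) <
    min (min (δ / 2) (1 / (k + 1 : ℝ) / 4)) (min 1 (1 / (J + 1 : ℝ) / 2)) by positivity)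
  simp only [lt_min_iff] at hN
  refine ⟨N, fun r s hr hrN hs hsN => ?_⟩
  have hsub : {y | |y i - x i| < r ∧ ‖(L + columnMap i t) (y - x)‖ < s * |y i - x i|} ⊆
      columnDirection i L x ⁻¹' ball t s ∩ {y | y i ≠ x i ∧ |y i - x i| < r} := by
    rintro y ⟨hyr, hy⟩
    have hne : y i ≠ x i := by
      intro h
      rw [h, sub_self, abs_zero, mul_zero] at hy
      exact absurd hy (not_lt.2 (norm_nonneg _))
    rw [norm_add_columnMap_apply i L hne, mul_comm s] at hy
    exact ⟨lt_of_mul_lt_mul_left hy (abs_nonneg _), hne, hyr⟩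
  refine (measure_mono hsub).trans ?_
  rw [← columnMeasure_apply r measurableSet_ball]
  set C := C₁ M k ∩ C₂ J with hC
  have hCm : MeasurableSet C := (hC₁c M k).measurableSet.inter (hC₂m J)
  -- The ball is cut in three: on `C` the density is of order `ε`; on `C₁ M k \ C` it is only of
  -- order `M`, but the volume is small; off `C₁ M k` the covering estimate applies, again against a
  -- small volume.
  have e1 : columnMeasure μ i L x r (ball t s ∩ C) ≤
      ε * ENNReal.ofReal (2 * r) ^ m * volume (ball t s ∩ C) :=
    columnMeasure_le_of_smallAnnuli (measurableSet_ball.inter hCm) (J := J)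
      (fun t' ht' => ht'.2.2) hr (by linarith [hN.2.2])
  have e2 : columnMeasure μ i L x r ((ball t s ∩ C₁ M k) \ C) ≤
      M * ENNReal.ofReal r ^ m * volume ((ball t s ∩ C₁ M k) \ C) := by
    have := measure_le_of_upperDensity_le (columnMeasure μ i L x r) (M * Real.toNNReal r ^ m)
      ((ball t s ∩ C₁ M k) \ C) fun t' ht' => ⟨1 / (k + 1 : ℝ) / r, by positivity, fun s' h0 hs' => ?_⟩
    · exact this.trans_eq (by push_cast; rfl)
    · have := columnMeasure_ball_le ht'.1.2 hr h0 (by rwa [lt_div_iff₀' hr] at hs')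
      rw [ballVol_mul hr h0, ← mul_assoc] at this
      exact this.trans_eq (by push_cast; rfl)
  have e3 : columnMeasure μ i L x r (ball t s \ C₁ M k) ≤
      M * ENNReal.ofReal (8 * r) ^ m * volume (closedBall t (2 * s) \ C₁ M k) :=
    columnMeasure_diff_le (hC₁c M k) (fun _ h => h) h1 hr (by linarith [hN.2.1]) hs
      (by linarith [hN.1.2])
  have e4 := hvol (2 * s) (by positivity) (by linarith [hN.1.1])
  have e5 : M * ENNReal.ofReal r ^ m * volume ((ball t s ∩ C₁ M k) \ C) ≤
      M * ENNReal.ofReal (8 * r) ^ m * (η * ballVol m (2 * s)) := by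
    gcongr
    · linarith
    · refine (measure_mono ?_).trans e4
      exact sdiff_subset_sdiff_left (inter_subset_left.trans
        (ball_subset_closedBall.trans (closedBall_subset_closedBall (by linarith))))
  have e6 : M * ENNReal.ofReal (8 * r) ^ m * volume (closedBall t (2 * s) \ C₁ M k) ≤
      M * ENNReal.ofReal (8 * r) ^ m * (η * ballVol m (2 * s)) := by
    gcongr
    exact (measure_mono (sdiff_subset_sdiff_right inter_subset_left)).trans e4
  have hcover : ball t s ⊆ (ball t s ∩ C) ∪ ((ball t s ∩ C₁ M k) \ C) ∪ (ball t s \ C₁ M k) := by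
    intro u hu
    by_cases hu1 : u ∈ C₁ M k
    · by_cases hu2 : u ∈ C
      · exact Or.inl (Or.inl ⟨hu, hu2⟩)
      · exact Or.inl (Or.inr ⟨⟨hu, hu1⟩, hu2⟩)
    · exact Or.inr ⟨hu, hu1⟩
  calc columnMeasure μ i L x r (ball t s)
      ≤ columnMeasure μ i L x r (ball t s ∩ C) + columnMeasure μ i L x r ((ball t s ∩ C₁ M k) \ C) +
        columnMeasure μ i L x r (ball t s \ C₁ M k) :=
        (measure_mono hcover).trans ((measure_union_le _ _).trans (by gcongr; exact measure_union_le _ _))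
    _ ≤ ε * ENNReal.ofReal (2 * r) ^ m * ballVol m s +
        M * ENNReal.ofReal (8 * r) ^ m * (η * ballVol m (2 * s)) +
        M * ENNReal.ofReal (8 * r) ^ m * (η * ballVol m (2 * s)) := by
        gcongr
        · refine e1.trans ?_
          gcongr
          exact (measure_mono inter_subset_left).trans_eq (volume_ball_eq t s)
        · exact e2.trans e5
        · exact e3.trans e6
    _ = ε * 2 ^ m * (ENNReal.ofReal r ^ m * ballVol m s) +
        2 * M * 8 ^ m * η * 2 ^ m * (ENNReal.ofReal r ^ m * ballVol m s) := by
        rw [ballVol_mul two_pos hs, ENNReal.ofReal_mul (by norm_num), ENNReal.ofReal_mul (by norm_num)]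
        simp only [mul_pow, ENNReal.ofReal_ofNat]
        ring
    _ ≤ ε * 2 ^ m * (ENNReal.ofReal r ^ m * ballVol m s) +
        ε * 2 ^ m * (ENNReal.ofReal r ^ m * ballVol m s) := by gcongr
    _ = ((2 ^ (m + 1) * ε : ℝ≥0) : ℝ≥0∞) * ballVol m (r * s) := by
        rw [ballVol_mul hr hs]
        push_cast
        ring

/-- For almost every linear map, small annuli imply small cones at almost every point. -/
theorem ae_ae_coneBound (m : ℕ) (μ : Measure (Euc n)) [IsFiniteMeasure μ] :
    ∀ᵐ (L : Euc n →L[ℝ] Euc m) ∂(clmHaar n m), ∀ᵐ x ∂μ, L x ∈ finiteDensitySet (μ.map L) →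
      ∀ (i : Fin n) (l : ℕ), SmallAnnuli μ i (1 / (l + 1)) x L →
        ∃ k : ℕ, ConeBound μ i (2 ^ (m + 1) * (1 / (l + 1))) (1 / (k + 1 : ℝ)) x L := by
  have hmeas : ∀ (i : Fin n) (l : ℕ), MeasurableSet {p : Euc n × (Euc n →L[ℝ] Euc m) |
      p.2 p.1 ∈ finiteDensitySet (μ.map p.2) → SmallAnnuli μ i (1 / (l + 1)) p.1 p.2 →
        ∃ k : ℕ, ConeBound μ i (2 ^ (m + 1) * (1 / (l + 1))) (1 / (k + 1 : ℝ)) p.1 p.2} := by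
    intro i l
    refine MeasurableSet.imp ?_ (MeasurableSet.imp (measurableSet_smallAnnuli μ i _) ?_)
    · simpa using measurableSet_mem_finiteDensitySet (m := m) μ (U := univ) isOpen_univ
    · simp only [ofPred_exists]
      exact MeasurableSet.iUnion fun k => (isClosed_coneBound μ i _ _).measurableSet
  have key : ∀ᵐ (L : Euc n →L[ℝ] Euc m) ∂(clmHaar n m), ∀ᵐ x ∂μ, ∀ (i : Fin n) (l : ℕ),
      L x ∈ finiteDensitySet (μ.map L) → SmallAnnuli μ i (1 / (l + 1)) x L →
        ∃ k : ℕ, ConeBound μ i (2 ^ (m + 1) * (1 / (l + 1))) (1 / (k + 1 : ℝ)) x L := by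
    refine (Measure.ae_ae_comm ?_).1 (Eventually.of_forall fun x => ?_)
    · simp only [ofPred_forall (ι := Fin n), ofPred_forall (ι := ℕ)]
      exact MeasurableSet.iInter fun i => MeasurableSet.iInter fun l => hmeas i l
    · simp only [ae_all_iff (ι := Fin n), ae_all_iff (ι := ℕ)]
      intro i l
      exact ae_of_forall_ae_add_columnMap i ((hmeas i l).preimage
        (by fun_prop : Measurable fun L : Euc n →L[ℝ] Euc m => (x, L)))
        fun L => ae_column_coneBound μ x i (by positivity) L
  filter_upwards [key] with L hL
  filter_upwards [hL] with x hx h i l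
  exact hx i l h

end Cones

/-! ### Disintegrations and densities -/

section Slices

variable {n m : ℕ}

theorem measurableSet_finiteDensitySet (α : Measure (Euc m)) :
    MeasurableSet (finiteDensitySet α) := by
  simp only [finiteDensitySet, ofPred_exists]
  refine MeasurableSet.iUnion fun M => MeasurableSet.iUnion fun k => IsClosed.measurableSet ?_
  simp only [ofPred_forall]
  refine isClosed_iInter fun ρ => isClosed_iInter fun _ => isClosed_iInter fun _ => ?_
  exact isClosed_setOf_measure_section_le α (O := {q : Euc m × Euc m | dist q.2 q.1 < ρ})
    (isOpen_lt (by fun_prop) continuous_const) _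

variable {μ : Measure (Euc n)} {L : Euc n →L[ℝ] Euc m} {κ : Kernel (Euc m) (Euc n)}

/-- Concentration on fibres gives `κ z (L ⁻¹' B ∩ U) = κ z U` for `z ∈ B` and `0` otherwise, for
almost every `z`. -/
theorem IsDisintegration.map_restrict_eq (hκ : IsDisintegration μ L κ) {U : Set (Euc n)}
    (hU : MeasurableSet U) :
    (μ.restrict U).map L = (μ.map L).withDensity fun z => κ z U := by
  ext B hB
  rw [Measure.map_apply (measurable_clm L) hB, Measure.restrict_apply (measurable_clm L hB),
    withDensity_apply _ hB, hκ.integral_eq _ ((measurable_clm L hB).inter hU),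
    ← lintegral_indicator hB]
  refine lintegral_congr_ae ?_
  filter_upwards [hκ.concentrated] with z hz
  by_cases hzB : z ∈ B
  · rw [indicator_of_mem hzB]
    refine le_antisymm (measure_mono inter_subset_right) ?_
    have : U ⊆ (L ⁻¹' B ∩ U) ∪ (L ⁻¹' {z})ᶜ := by
      intro x hx
      by_cases hxz : L x = z
      · exact Or.inl ⟨by rwa [mem_preimage, hxz], hx⟩
      · exact Or.inr hxz
    refine (measure_mono this).trans ((measure_union_le _ _).trans ?_)
    rw [show κ z (L ⁻¹' {z})ᶜ = 0 from hz, add_zero]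
  · rw [indicator_of_notMem hzB]
    refine measure_mono_null ?_ hz
    rintro x ⟨hx, -⟩ (hxz : L x = z)
    exact hzB (hxz ▸ hx)

theorem IsDisintegration.rnDeriv_map_restrict [IsFiniteMeasure μ] (hκ : IsDisintegration μ L κ) {U : Set (Euc n)}
    (hU : MeasurableSet U) : ((μ.restrict U).map L).rnDeriv volume =ᵐ[volume]
      fun z => κ z U * (μ.map L).rnDeriv volume z := by
  have := hκ.isProbabilityMeasure
  rw [hκ.map_restrict_eq hU]
  exact Measure.rnDeriv_withDensity_left (κ.measurable_coe hU).aemeasurable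
    (Eventually.of_forall fun z => measure_ne_top _ _)

theorem IsDisintegration.ae_tendsto [IsFiniteMeasure μ] (hκ : IsDisintegration μ L κ) {U : Set (Euc n)}
    (hU : MeasurableSet U) : ∀ᵐ z, Tendsto
      (fun r => (μ.restrict U).map L (closedBall z r) / volume (closedBall z r)) (𝓝[>] 0)
      (𝓝 (κ z U * (μ.map L).rnDeriv volume z)) := by
  filter_upwards [Besicovitch.ae_tendsto_rnDeriv ((μ.restrict U).map L) volume,
    hκ.rnDeriv_map_restrict hU] with z h1 h2
  rwa [h2] at h1

/-- `μ.map L` is absolutely continuous on its finite density set, so Lebesgue-generic facts about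
`z` become `μ`-generic facts about `x`. -/
theorem ae_of_ae_volume (μ : Measure (Euc n)) [IsFiniteMeasure μ] (L : Euc n →L[ℝ] Euc m)
    {p : Euc m → Prop} (h : ∀ᵐ z, p z) :
    ∀ᵐ x ∂μ, L x ∈ finiteDensitySet (μ.map L) → p (L x) := by
  refine ae_of_ae_map (p := fun z => z ∈ finiteDensitySet (μ.map L) → p z)
    (measurable_clm L).aemeasurable ?_
  have := measure_eq_zero_of_subset_finiteDensitySet (μ.map L)
    (S := {z | z ∈ finiteDensitySet (μ.map L) ∧ ¬ p z}) (fun z hz => hz.1)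
    (measure_mono_null (fun z hz => hz.2) h)
  rw [ae_iff]
  simpa only [Classical.not_imp] using this

/-- The punctured cylinders `B N` decrease to the empty set, so `κ (L x) (B N) * f` tends to `0`; a
possible atom at `x` is excluded by the puncture. Every annulus inside `B N` is covered by two
rational slabs, one on each side of `x`, and rational slabs are countably many, so their densities
are known simultaneously. -/
theorem IsDisintegration.ae_smallAnnuli [IsFiniteMeasure μ] (hκ : IsDisintegration μ L κ) :
    ∀ᵐ x ∂μ, L x ∈ finiteDensitySet (μ.map L) →
      ∀ (i : Fin n) (ε : ℝ≥0), 0 < ε → SmallAnnuli μ i ε x L := by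
  have hprob := hκ.isProbabilityMeasure
  have h1 : ∀ᵐ z : Euc m, (μ.map L).rnDeriv volume z ≠ ∞ ∧ ∀ (i : Fin n) (a b : ℚ), Tendsto
      (fun r => (μ.restrict (slab i a b)).map L (closedBall z r) / volume (closedBall z r)) (𝓝[>] 0)
      (𝓝 (κ z (slab i a b) * (μ.map L).rnDeriv volume z)) := by
    refine Filter.Eventually.and ?_ ?_
    · filter_upwards [(μ.map L).rnDeriv_lt_top volume] with z hz using hz.ne
    · simp only [ae_all_iff]
      exact fun i a b => hκ.ae_tendsto (isOpen_slab i _ _).measurableSet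
  filter_upwards [ae_of_ae_volume μ L h1] with x hx hFD i ε hε
  obtain ⟨hfin, hlim⟩ := hx hFD
  set f := (μ.map L).rnDeriv volume (L x)
  set B : ℕ → Set (Euc n) := fun N => {y | 0 < |y i - x i| ∧ |y i - x i| < 1 / (N + 1 : ℝ)} with hB
  have hBm : ∀ N, MeasurableSet (B N) := fun N =>
    (IsOpen.and (isOpen_lt continuous_const
      (by fun_prop : Continuous fun y : Euc n => |y i - x i|)) (isOpen_lt
      (by fun_prop : Continuous fun y : Euc n => |y i - x i|) continuous_const)).measurableSet
  have hBanti : Antitone B := fun N N' hN y hy => ⟨hy.1, hy.2.trans_le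
    (one_div_le_one_div_of_le (by positivity) (by exact_mod_cast Nat.succ_le_succ hN))⟩
  have hB0 : ⋂ N, B N = ∅ := by
    refine eq_empty_of_forall_notMem fun y hy => ?_
    rw [mem_iInter] at hy
    obtain ⟨N, hN⟩ := exists_nat_one_div_lt (hy 0).1
    exact absurd (hy N).2 hN.not_gt
  have htend : Tendsto (fun N => κ (L x) (B N) * f) atTop (𝓝 0) := by
    have h2 := tendsto_measure_iInter_atTop (μ := κ (L x))
      (fun N => (hBm N).nullMeasurableSet) hBanti ⟨0, measure_ne_top _ _⟩
    rw [hB0, measure_empty] at h2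
    simpa using ENNReal.Tendsto.mul_const h2 (Or.inr hfin)
  obtain ⟨N, hN⟩ := (htend.eventually (gt_mem_nhds (show (0 : ℝ≥0∞) < (ε / 2 : ℝ≥0) by
    exact_mod_cast half_pos hε))).exists
  refine ⟨N, fun δ r hδ hr => ?_⟩
  have hδ' : (0 : ℝ) < δ := by exact_mod_cast hδ
  obtain ⟨a₁, ha₁, ha₁'⟩ := exists_rat_btwn (show x i - 1 / (N + 1 : ℝ) < x i - r by linarith)
  obtain ⟨b₁, hb₁, hb₁'⟩ := exists_rat_btwn (show x i - δ < x i by linarith)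
  obtain ⟨a₂, ha₂, ha₂'⟩ := exists_rat_btwn (show x i < x i + δ by linarith)
  obtain ⟨b₂, hb₂, hb₂'⟩ := exists_rat_btwn (show x i + r < x i + 1 / (N + 1 : ℝ) by linarith)
  have hsub₁ : slab i (a₁ : ℝ) b₁ ⊆ B N := by
    rintro y ⟨h3, h4⟩
    exact ⟨abs_pos.2 (by linarith), abs_lt.2 ⟨by linarith, by
      have : (0 : ℝ) < 1 / (N + 1 : ℝ) := by positivity
      linarith⟩⟩
  have hsub₂ : slab i (a₂ : ℝ) b₂ ⊆ B N := by
    rintro y ⟨h3, h4⟩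
    exact ⟨abs_pos.2 (by linarith), abs_lt.2 ⟨by
      have : (0 : ℝ) < 1 / (N + 1 : ℝ) := by positivity
      linarith, by linarith⟩⟩
  have hlt : ∀ a b : ℚ, slab i (a : ℝ) b ⊆ B N → ∃ k : ℕ, ∀ ρ, 0 < ρ → ρ < 1 / (k + 1 : ℝ) →
      μ {y | y ∈ slab i (a : ℝ) b ∧ ‖L (y - x)‖ < ρ} ≤ (ε / 2 : ℝ≥0) * ballVol m ρ := by
    intro a b hab
    have h3 : κ (L x) (slab i (a : ℝ) b) * f < (ε / 2 : ℝ≥0) :=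
      (mul_le_mul_left (measure_mono hab) f).trans_lt hN
    obtain ⟨k, hk⟩ := measure_le_of_density_lt (hlim i a b) h3
    refine ⟨k, fun ρ h0 hρ => ?_⟩
    rw [← map_restrict_ball]
    exact hk ρ h0 hρ
  obtain ⟨k₁, hk₁⟩ := hlt a₁ b₁ hsub₁
  obtain ⟨k₂, hk₂⟩ := hlt a₂ b₂ hsub₂
  refine ⟨max k₁ k₂, fun ρ h0 hρ => ?_⟩
  have hle₁ : (1 : ℝ) / ((max k₁ k₂ : ℕ) + 1 : ℝ) ≤ 1 / (k₁ + 1 : ℝ) :=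
    one_div_le_one_div_of_le (by positivity) (by exact_mod_cast Nat.succ_le_succ (le_max_left _ _))
  have hle₂ : (1 : ℝ) / ((max k₁ k₂ : ℕ) + 1 : ℝ) ≤ 1 / (k₂ + 1 : ℝ) :=
    one_div_le_one_div_of_le (by positivity) (by exact_mod_cast Nat.succ_le_succ (le_max_right _ _))
  calc μ {y | y ∈ annulus i x δ r ∧ ‖L (y - x)‖ < ρ}
      ≤ μ ({y | y ∈ slab i (a₁ : ℝ) b₁ ∧ ‖L (y - x)‖ < ρ} ∪
          {y | y ∈ slab i (a₂ : ℝ) b₂ ∧ ‖L (y - x)‖ < ρ}) := measure_mono ?_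
    _ ≤ (ε / 2 : ℝ≥0) * ballVol m ρ + (ε / 2 : ℝ≥0) * ballVol m ρ :=
        (measure_union_le _ _).trans (add_le_add (hk₁ ρ h0 (hρ.trans_le hle₁))
          (hk₂ ρ h0 (hρ.trans_le hle₂)))
    _ = ε * ballVol m ρ := by rw [← add_mul, ← ENNReal.coe_add, add_halves]
  rintro y ⟨⟨hy1, hy2⟩, hy3⟩
  rcases lt_or_ge (y i) (x i) with h | h
  · rw [abs_of_neg (by linarith)] at hy1 hy2
    exact Or.inl ⟨⟨by linarith, by linarith⟩, hy3⟩
  · rw [abs_of_nonneg (by linarith)] at hy1 hy2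
    exact Or.inr ⟨⟨by linarith, by linarith⟩, hy3⟩

end Slices

/-! ### Lipschitz graphs inside purely unrectifiable sets -/

section Graphs

variable {n m : ℕ}

theorem volume_absolutelyContinuous_hausdorffMeasure (m : ℕ) :
    (volume : Measure (Euc m)) ≪ Measure.hausdorffMeasure (m : ℝ) := by
  have h : Measure.IsAddHaarMeasure (Measure.hausdorffMeasure (m : ℝ) : Measure (Euc m)) := by
    simpa using isAddHaarMeasure_hausdorffMeasure (E := Euc m)
  exact Measure.absolutelyContinuous_isAddHaarMeasure _ _

theorem isCountablyRectifiable_range {f : Euc m → Euc n} {K : ℝ≥0} (hf : LipschitzWith K f) :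
    IsCountablyRectifiable m (range f) := by
  have h : range f = ⋃ k : ℕ, f '' closedBall 0 (k : ℝ) := by
    rw [← image_iUnion, iUnion_closedBall_nat, image_univ]
  refine ⟨?_, fun k => closedBall 0 k, fun _ => f, fun k => isBounded_closedBall,
    fun k => ⟨K, hf.lipschitzOnWith⟩, h⟩
  rw [h]
  exact MeasurableSet.iUnion fun k =>
    ((isCompact_closedBall _ _).image hf.continuous).measurableSet

/-- The cone condition makes `L` injective on `A` with Lipschitz inverse. Extended coordinatewise to
`ℝᵐ`, the inverse has a rectifiable range containing `A`; hence `A`, and so its Lipschitz image, is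
`ℋ^m`-null. -/
theorem IsPurelyUnrectifiable.volume_image_eq_zero {E : Set (Euc n)}
    (hE : IsPurelyUnrectifiable m E) (L : Euc n →L[ℝ] Euc m) {A : Set (Euc n)} (hA : A ⊆ E)
    {s : ℝ} (hs : 0 < s) (h : ∀ a ∈ A, ∀ b ∈ A, ∀ i, s * |b i - a i| ≤ ‖L (b - a)‖) :
    volume (L '' A) = 0 := by
  have hinj : ∀ a ∈ A, ∀ b ∈ A, dist (WithLp.ofLp a) (WithLp.ofLp b) ≤ s⁻¹ * dist (L a) (L b) := by
    intro a ha b hb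
    rw [dist_pi_le_iff (by positivity)]
    intro i
    rw [le_inv_mul_iff₀ hs, dist_eq_norm (L a), ← map_sub, Real.dist_eq]
    exact h b hb a ha i
  set g : Euc m → Euc n := Function.invFunOn L A with hg
  have hgA : ∀ u ∈ L '' A, g u ∈ A ∧ L (g u) = u := fun u hu =>
    ⟨Function.invFunOn_mem hu, Function.invFunOn_eq hu⟩
  have hlip : LipschitzOnWith (Real.toNNReal s⁻¹) (fun u => WithLp.ofLp (g u)) (L '' A) := by
    refine LipschitzOnWith.of_dist_le_mul fun u hu v hv => ?_
    have := hinj _ (hgA u hu).1 _ (hgA v hv).1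
    rwa [(hgA u hu).2, (hgA v hv).2, ← Real.coe_toNNReal s⁻¹ (by positivity)] at this
  obtain ⟨f, hf, hfg⟩ := hlip.extend_pi
  have hF : LipschitzWith _ (fun u => (WithLp.toLp 2 (f u) : Euc n)) :=
    (PiLp.lipschitzWith_toLp 2 fun _ : Fin n => ℝ).comp hf
  have hsub : A ⊆ E ∩ range fun u => (WithLp.toLp 2 (f u) : Euc n) := by
    refine fun a ha => ⟨hA ha, L a, ?_⟩
    have h1 := hgA (L a) (mem_image_of_mem _ ha)
    have h2 := hinj _ h1.1 a ha
    rw [h1.2, dist_self, mul_zero] at h2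
    have h3 : WithLp.ofLp (g (L a)) = WithLp.ofLp a := dist_le_zero.1 h2
    change WithLp.toLp 2 (f (L a)) = a
    have h4 : WithLp.ofLp (g (L a)) = f (L a) := hfg (mem_image_of_mem _ ha)
    rw [← h4, h3]
  have h0 : Measure.hausdorffMeasure (m : ℝ) A = 0 :=
    measure_mono_null hsub (hE _ (isCountablyRectifiable_range hF))
  refine volume_absolutelyContinuous_hausdorffMeasure m ?_
  have := (L.lipschitz.lipschitzOnWith (s := A)).hausdorffMeasure_image_le (d := m) (by positivity)
  rw [h0, mul_zero] at this
  exact le_antisymm this zero_le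

theorem exists_near_sup {T : Set ℝ} (hT : T.Nonempty) {d : ℝ} (hpos : ∀ t ∈ T, 0 < t)
    (hd : ∀ t ∈ T, t ≤ d) : ∃ h, 0 < h ∧ h ≤ d ∧ (∀ t ∈ T, t ≤ h) ∧ ∃ t ∈ T, 3 / 4 * h < t := by
  have hbdd : BddAbove T := ⟨d, hd⟩
  obtain ⟨t₀, ht₀⟩ := hT
  have h0 : 0 < sSup T := (hpos t₀ ht₀).trans_le (le_csSup hbdd ht₀)
  refine ⟨sSup T, h0, csSup_le ⟨t₀, ht₀⟩ hd, fun t ht => le_csSup hbdd ht, ?_⟩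
  exact exists_lt_of_lt_csSup ⟨t₀, ht₀⟩ (by linarith)

theorem ConeBound.mono {μ : Measure (Euc n)} {i : Fin n} {ε : ℝ≥0} {η η' : ℝ} {x : Euc n}
    {L : Euc n →L[ℝ] Euc m} (h : ConeBound μ i ε η x L) (hη : η' ≤ η) : ConeBound μ i ε η' x L :=
  fun r s hr hr' hs hs' => h r s hr (hr'.trans_le hη) hs (hs'.trans_le hη)

/-- If all cones with vertex in `A` have small measure and `a` has a further point of `A` in its
cone, then a tube around `a` of some width meets `A` in a set of small measure. -/
theorem exists_tube_measure_le {μ : Measure (Euc n)} {L : Euc n →L[ℝ] Euc m} {ε : ℝ≥0} {η : ℝ}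
    {A : Set (Euc n)} (hcone : ∀ a ∈ A, ∀ i, ConeBound μ i ε η a L) {d s : ℝ} (hs : 0 < s)
    (hdiam : ∀ a ∈ A, ∀ b ∈ A, ∀ i, |b i - a i| ≤ d) (hdη : 2 * d < η) (hsη : 3 * s < η)
    {a : Euc n} (ha : a ∈ A) (hex : ∃ b ∈ A, ∃ i, ‖L (b - a)‖ < s * |b i - a i|) :
    ∃ h, 0 < h ∧ h ≤ d ∧
      μ {b | b ∈ A ∧ ‖L (b - a)‖ < s * h / 4} ≤ 2 * n * ε * ballVol m (6 * (s * h)) := by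
  -- `h` is the supremal height of points of `A` in the cone at `a`, almost attained by `a'` in the
  -- coordinate `j`. A point of `A` in the tube then lies in the cone at `a`, or in the wider cone
  -- at `a'`.
  obtain ⟨h, h0, hd, hsup, t, ⟨a', ha', j, hj, rfl⟩, ht⟩ := exists_near_sup
    (T := {t | ∃ b ∈ A, ∃ i, ‖L (b - a)‖ < s * |b i - a i| ∧ t = |b i - a i|}) (d := d)
    (by obtain ⟨b, hb, i, hi⟩ := hex; exact ⟨_, b, hb, i, hi, rfl⟩)
    (by
      rintro _ ⟨b, hb, i, hi, rfl⟩
      exact pos_of_mul_pos_right ((norm_nonneg _).trans_lt hi) hs.le)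
    (by rintro _ ⟨b, hb, i, hi, rfl⟩; exact hdiam a ha b hb i)
  have hj' : |a' j - a j| ≤ h := hsup _ ⟨a', ha', j, hj, rfl⟩
  refine ⟨h, h0, hd, ?_⟩
  have hsub : {b | b ∈ A ∧ ‖L (b - a)‖ < s * h / 4} ⊆
      (⋃ i, {y | |y i - a i| < 2 * h ∧ ‖L (y - a)‖ < s * |y i - a i|}) ∪
        (⋃ i, {y | |y i - a' i| < 2 * h ∧ ‖L (y - a')‖ < 3 * s * |y i - a' i|}) := by
    rintro b ⟨hb, hbt⟩
    by_cases hc : ∃ i, ‖L (b - a)‖ < s * |b i - a i|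
    · obtain ⟨i, hi⟩ := hc
      exact Or.inl (mem_iUnion.2 ⟨i, (hsup _ ⟨b, hb, i, hi, rfl⟩).trans_lt (by linarith), hi⟩)
    -- Outside the cones at `a`, `b` has height below `h / 4`, hence is more than `3h/4 - h/4 = h/2`
    -- away from `a'`, while `‖L (b - a')‖ < sh/4 + sh < 3s · h/2`.
    · push Not at hc
      have h1 : |b j - a j| < h / 4 := by
        have := (hc j).trans_lt hbt
        rw [mul_div_assoc] at this
        exact lt_of_mul_lt_mul_left this hs.le
      have h2 : h / 2 < |b j - a' j| := by
        have := abs_sub_abs_le_abs_sub (a' j - a j) (b j - a j)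
        rw [show a' j - a j - (b j - a j) = -(b j - a' j) by ring, abs_neg] at this
        linarith
      have h3 : |b j - a' j| < 2 * h := by
        have := abs_sub (b j - a j) (a' j - a j)
        rw [show b j - a j - (a' j - a j) = b j - a' j by ring] at this
        linarith
      refine Or.inr (mem_iUnion.2 ⟨j, h3, ?_⟩)
      have h4 : ‖L (b - a')‖ ≤ ‖L (b - a)‖ + ‖L (a' - a)‖ := by
        have := norm_sub_le (L (b - a)) (L (a' - a))
        rwa [← map_sub, sub_sub_sub_cancel_right] at this
      have h5 : s * |a' j - a j| ≤ s * h := mul_le_mul_of_nonneg_left hj' hs.le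
      have h6 : s * (h / 2) < s * |b j - a' j| := mul_lt_mul_of_pos_left h2 hs
      have h7 : 0 < s * h := mul_pos hs h0
      linarith
  refine (measure_mono hsub).trans ((measure_union_le _ _).trans ?_)
  have hb1 : μ (⋃ i, {y | |y i - a i| < 2 * h ∧ ‖L (y - a)‖ < s * |y i - a i|}) ≤
      n * (ε * ballVol m (6 * (s * h))) := by
    refine (measure_iUnion_fintype_le _ _).trans ?_
    refine (Finset.sum_le_card_nsmul _ _ (ε * ballVol m (6 * (s * h))) fun i _ => ?_).trans_eq
      (by simp)
    refine (hcone a ha i (2 * h) s (by linarith) (by linarith) hs (by linarith)).trans ?_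
    gcongr
    exact ballVol_mono (by nlinarith [mul_pos hs h0])
  have hb2 : μ (⋃ i, {y | |y i - a' i| < 2 * h ∧ ‖L (y - a')‖ < 3 * s * |y i - a' i|}) ≤
      n * (ε * ballVol m (6 * (s * h))) := by
    refine (measure_iUnion_fintype_le _ _).trans ?_
    refine (Finset.sum_le_card_nsmul _ _ (ε * ballVol m (6 * (s * h))) fun i _ => ?_).trans_eq
      (by simp)
    refine (hcone a' ha' i (2 * h) (3 * s) (by linarith) (by linarith) (by linarith)
      (by linarith)).trans ?_
    gcongr
    exact ballVol_mono (by nlinarith [mul_pos hs h0])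
  refine (add_le_add hb1 hb2).trans_eq (by ring)

/-- Small cones with vertices in a set force the projection of that set to have small density. -/
theorem map_restrict_ball_le {μ : Measure (Euc n)} [IsFiniteMeasure μ] {E : Set (Euc n)}
    (hE : IsPurelyUnrectifiable m E) (hμE : IsConcentratedOn μ E) {L : Euc n →L[ℝ] Euc m}
    {ε : ℝ≥0} {η d : ℝ} {Q : Set (Euc n)} (hQ : MeasurableSet Q)
    (hFD : ∀ x ∈ Q, L x ∈ finiteDensitySet (μ.map L))
    (hcone : ∀ a ∈ Q, ∀ i, ConeBound μ i ε η a L) (hd : 0 < d)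
    (hdiam : ∀ a ∈ Q, ∀ b ∈ Q, ∀ i, |b i - a i| ≤ d) (hdη : 2 * d < η)
    (z : Euc m) {ρ : ℝ} (hρ : 0 < ρ) (hρη : 3 * (ρ / d) < η) :
    (μ.restrict Q).map L (ball z ρ) ≤
      ((2 * n * ε * 240 ^ m * 2 ^ m : ℝ≥0) : ℝ≥0∞) * ballVol m ρ := by
  -- With this aperture a cone of height `d` has width `ρ`, so every `s * h` with `h ≤ d` is at most
  -- `ρ`.
  set s := ρ / d with hs_def
  have hs : 0 < s := div_pos hρ hd
  have hsd : s * d = ρ := div_mul_cancel₀ _ hd.ne'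
  set A := Q ∩ E with hA
  set A₀ := {a | a ∈ A ∧ ∀ b ∈ A, ∀ i, s * |b i - a i| ≤ ‖L (b - a)‖} with hA₀
  set S := ball z ρ ∩ L '' (A \ A₀) with hS
  -- The points without companions in their cone have null image by pure unrectifiability; this
  -- image consists of finite density points, so it is also null for `μ.map L`.
  have hμA₀ : μ A₀ = 0 := by
    have h1 := hE.volume_image_eq_zero L (A := A₀) (fun a ha => ha.1.2) hs
      (fun a ha b hb i => ha.2 b hb.1 i)
    have h2 := measure_eq_zero_of_subset_finiteDensitySet (μ.map L) (S := L '' A₀)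
      (by rintro _ ⟨a, ha, rfl⟩; exact hFD a ha.1.1) h1
    refine measure_mono_null (subset_preimage_image L A₀) ?_
    exact le_antisymm ((Measure.le_map_apply (measurable_clm L).aemeasurable _).trans h2.le)
      zero_le
  have hsec : ∀ B : Set (Euc n), μ (B ∩ Q) ≤ μ (B ∩ A) := by
    intro B
    have : B ∩ Q ⊆ (B ∩ A) ∪ Eᶜ := by
      rintro x ⟨hx, hxQ⟩
      by_cases hxE : x ∈ E
      · exact Or.inl ⟨hx, hxQ, hxE⟩
      · exact Or.inr hxE
    refine (measure_mono this).trans ((measure_union_le _ _).trans ?_)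
    rw [show μ Eᶜ = 0 from hμE, add_zero]
  have hball : (μ.restrict Q).map L (ball z ρ) ≤ (μ.restrict Q).map L S := by
    rw [Measure.map_apply (measurable_clm L) measurableSet_ball, Measure.restrict_apply' hQ]
    refine (hsec _).trans ?_
    have h1 : L ⁻¹' ball z ρ ∩ A ⊆ (L ⁻¹' S ∩ Q) ∪ A₀ := by
      rintro x ⟨hx, hxA⟩
      by_cases hx0 : x ∈ A₀
      · exact Or.inr hx0
      · exact Or.inl ⟨⟨hx, mem_image_of_mem _ ⟨hxA, hx0⟩⟩, hxA.1⟩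
    refine (measure_mono h1).trans ((measure_union_le _ _).trans ?_)
    rw [hμA₀, add_zero, ← Measure.restrict_apply' hQ]
    exact Measure.le_map_apply (measurable_clm L).aemeasurable _
  have hex : ∀ u : Euc m, ∃ h, u ∈ S → 0 < h ∧ h ≤ d ∧
      μ ({b | ‖L b - u‖ < s * h / 4} ∩ A) ≤ 2 * n * ε * ballVol m (6 * (s * h)) := by
    intro u
    by_cases hu : u ∈ S
    · obtain ⟨-, a, ⟨haA, ha0⟩, rfl⟩ := hu
      have : ∃ b ∈ A, ∃ i, ‖L (b - a)‖ < s * |b i - a i| := by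
        by_contra! h
        exact ha0 ⟨haA, h⟩
      obtain ⟨h, h0, hd', hm⟩ := exists_tube_measure_le (fun a ha => hcone a ha.1) hs
        (fun a ha b hb => hdiam a ha.1 b hb.1) hdη hρη haA this
      refine ⟨h, fun _ => ⟨h0, hd', hm.trans' (measure_mono ?_)⟩⟩
      rintro b ⟨hb, hbA⟩
      exact ⟨hbA, by rw [map_sub]; exact hb⟩
    · exact ⟨0, fun h => absurd h hu⟩
  choose h hh using hex
  refine hball.trans ?_
  have hsh : ∀ u ∈ S, 0 < s * h u ∧ s * h u ≤ ρ := fun u hu =>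
    ⟨mul_pos hs (hh u hu).1, by rw [← hsd]; exact mul_le_mul_of_nonneg_left (hh u hu).2.1 hs.le⟩
  -- With radius `s * h u / 40` the fivefold enlargement stays inside the tube of width `s * h u /
  -- 4`, and `6 * (s * h u)` is 240 times this radius.
  refine (measure_le_of_forall_closedBall ((μ.restrict Q).map L) (2 * n * ε * 240 ^ m) S
    (ball z (2 * ρ)) (fun u => s * h u / 40) ρ (fun u hu => by linarith [hsh u hu])
    (fun u hu => by linarith [hsh u hu]) ?_ ?_).trans_eq ?_
  · intro u hu w hw
    rw [mem_closedBall] at hw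
    rw [mem_ball]
    have : dist u z < ρ := hu.1
    linarith [dist_triangle w u z, hsh u hu]
  · intro u hu
    rw [Measure.map_apply (measurable_clm L) measurableSet_closedBall, Measure.restrict_apply' hQ]
    refine (hsec _).trans ((measure_mono ?_).trans ((hh u hu).2.2.trans_eq ?_))
    · rintro b ⟨hb, hbA⟩
      refine ⟨?_, hbA⟩
      rw [mem_preimage, mem_closedBall, dist_eq_norm] at hb
      have := hsh u hu
      change ‖L b - u‖ < _
      linarith
    · rw [show 6 * (s * h u) = 240 * (s * h u / 40) by ring,
        ballVol_mul (by norm_num) (by linarith [hsh u hu])]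
      simp only [ENNReal.ofReal_ofNat]
      ring
  · rw [volume_ball_eq, ballVol_mul two_pos hρ]
    push_cast
    simp only [ENNReal.ofReal_ofNat]
    ring

end Graphs

/-! ### Projections of measures on purely unrectifiable sets -/

section Unrectifiable

variable {n m : ℕ}

/-- On `Q l k` the cone bounds hold with constant `c / (l + 1)` at one common scale, so its small
pieces have projected density of order `1 / (l + 1)`. Atomicity enters only in `hzero`: to kill `κ z
Q'` it is enough to kill its atoms. -/
theorem mutuallySingular_of_coneBound {μ : Measure (Euc n)} [IsFiniteMeasure μ] {E : Set (Euc n)}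
    (hE : IsPurelyUnrectifiable m E) (hμE : IsConcentratedOn μ E) {L : Euc n →L[ℝ] Euc m}
    {κ : Kernel (Euc m) (Euc n)} (hκ : IsDisintegration μ L κ)
    (hat : ∀ᵐ y, IsPurelyAtomic (κ y)) {c : ℝ≥0}
    (hcone : ∀ᵐ x ∂μ, L x ∈ finiteDensitySet (μ.map L) → ∀ (i : Fin n) (l : ℕ), ∃ k : ℕ,
      ConeBound μ i (c * (1 / (l + 1))) (1 / (k + 1 : ℝ)) x L) :
    (μ.map L).MutuallySingular volume := by
  set Q : ℕ → ℕ → Set (Euc n) := fun l k => {x | L x ∈ finiteDensitySet (μ.map L) ∧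
    ∀ i, ConeBound μ i (c * (1 / (l + 1))) (1 / (k + 1 : ℝ)) x L} with hQ
  have hFDm : MeasurableSet {x | L x ∈ finiteDensitySet (μ.map L)} :=
    measurable_clm L (measurableSet_finiteDensitySet _)
  have hQm : ∀ l k, MeasurableSet (Q l k) := by
    intro l k
    have h : MeasurableSet (⋂ i, {x | ConeBound μ i (c * (1 / (l + 1))) (1 / (k + 1 : ℝ)) x L}) :=
      MeasurableSet.iInter fun i => IsClosed.measurableSet <|
        (isClosed_coneBound (m := m) μ i (c * (1 / (l + 1))) (1 / (k + 1 : ℝ))).preimage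
          (by fun_prop : Continuous fun x : Euc n => (x, L))
    rw [← ofPred_forall] at h
    exact hFDm.inter h
  set Q' : Set (Euc n) := ⋂ l, ⋃ k, Q l k with hQ'
  have hQ'm : MeasurableSet Q' := MeasurableSet.iInter fun l => MeasurableSet.iUnion fun k => hQm l k
  have hcover : ∀ᵐ x ∂μ, L x ∈ finiteDensitySet (μ.map L) → x ∈ Q' := by
    filter_upwards [hcone] with x hx hFD
    refine mem_iInter.2 fun l => mem_iUnion.2 ?_
    choose k hk using fun i => hx hFD i l
    refine ⟨Finset.univ.sup k, hFD, fun i => (hk i).mono ?_⟩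
    refine one_div_le_one_div_of_le (by positivity) ?_
    exact_mod_cast Nat.succ_le_succ (Finset.le_sup (f := k) (Finset.mem_univ i))
  -- Radius `η / 8`, where `η = 1 / (k + 1)`, gives diameter at most `d = η / 4`, as
  -- `map_restrict_ball_le` needs `2 * d < η`.
  set U : ℕ → ℕ → Set (Euc n) := fun k p =>
    ball (TopologicalSpace.denseSeq (Euc n) p) (1 / (k + 1 : ℝ) / 8) with hU
  have hdens : ∀ᵐ z : Euc m, ∀ l k p, κ z (Q l k ∩ U k p) * (μ.map L).rnDeriv volume z ≤
      ((2 * n * (c * (1 / (l + 1))) * 240 ^ m * 2 ^ m : ℝ≥0) : ℝ≥0∞) := by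
    simp only [ae_all_iff]
    intro l k p
    have hm : MeasurableSet (Q l k ∩ U k p) := (hQm l k).inter measurableSet_ball
    have hk : (0 : ℝ) < 1 / (k + 1 : ℝ) := by positivity
    filter_upwards [hκ.ae_tendsto hm] with z hz
    refine density_le_of_measure_le (δ := 1 / (k + 1 : ℝ) * (1 / (k + 1 : ℝ) / 4) / 3)
      (by positivity) hz fun ρ h0 hρ => ?_
    refine map_restrict_ball_le hE hμE hm (fun x hx => hx.1.1) (fun x hx => hx.1.2)
      (η := 1 / (k + 1 : ℝ)) (d := 1 / (k + 1 : ℝ) / 4) (by positivity) ?_ (by linarith) z h0 ?_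
    · intro a ha b hb i
      have h1 : |b i - a i| ≤ dist b a := by
        rw [dist_eq_norm]
        exact PiLp.norm_apply_le (b - a) i
      have h2 : dist a _ < _ := ha.2
      have h3 : dist b _ < _ := hb.2
      linarith [dist_triangle_right b a (TopologicalSpace.denseSeq (Euc n) p)]
    · rw [← mul_div_assoc, div_lt_iff₀ (by positivity)]
      linarith
  have hzero : ∀ᵐ z : Euc m, κ z Q' * (μ.map L).rnDeriv volume z = 0 := by
    filter_upwards [hdens, hat] with z hz ⟨C, hC, hCκ⟩
    by_contra hne
    have hf : (μ.map L).rnDeriv volume z ≠ 0 := right_ne_zero_of_mul hne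
    refine left_ne_zero_of_mul hne ?_
    -- For each `l`, `x` lies in some piece `Q l k ∩ U k p`, so its atom is bounded by the density
    -- of that piece; then `l → ∞`.
    have hpt : ∀ x ∈ Q', κ z {x} = 0 := by
      intro x hx
      have hle : ∀ l : ℕ, κ z {x} * (μ.map L).rnDeriv volume z ≤
          ((2 * n * (c * (1 / (l + 1))) * 240 ^ m * 2 ^ m : ℝ≥0) : ℝ≥0∞) := by
        intro l
        obtain ⟨k, hk⟩ := mem_iUnion.1 (mem_iInter.1 hx l)
        obtain ⟨p, hp⟩ := (TopologicalSpace.denseRange_denseSeq (Euc n)).exists_dist_lt x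
          (show (0 : ℝ) < 1 / (k + 1 : ℝ) / 8 by positivity)
        refine le_trans ?_ (hz l k p)
        gcongr
        exact singleton_subset_iff.2 ⟨hk, hp⟩
      have hlim : Tendsto (fun l : ℕ =>
          ((2 * n * (c * (1 / (l + 1))) * 240 ^ m * 2 ^ m : ℝ≥0) : ℝ≥0∞)) atTop (𝓝 0) := by
        rw [← ENNReal.coe_zero, ENNReal.tendsto_coe]
        have h1 : Tendsto (fun l : ℕ => (1 : ℝ≥0) / (l + 1)) atTop (𝓝 0) :=
          tendsto_one_div_add_atTop_nhds_zero_nat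
        simpa using (((h1.const_mul c).const_mul (2 * n : ℝ≥0)).mul_const (240 ^ m)).mul_const (2 ^ m)
      have := le_antisymm (ge_of_tendsto' hlim hle) zero_le
      exact (mul_eq_zero.1 this).resolve_right hf
    have hsub : Q' ⊆ (⋃ x ∈ Q' ∩ C, {x}) ∪ Cᶜ := by
      intro x hx
      by_cases hxC : x ∈ C
      · exact Or.inl (mem_biUnion (⟨hx, hxC⟩ : x ∈ Q' ∩ C) rfl)
      · exact Or.inr hxC
    refine measure_mono_null hsub (measure_union_null ?_ hCκ)
    exact (measure_biUnion_null_iff (hC.mono inter_subset_right)).2 fun x hx => hpt x hx.1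
  have hsing : ((μ.restrict Q').map L).MutuallySingular volume := by
    rw [← Measure.rnDeriv_eq_zero]
    filter_upwards [hκ.rnDeriv_map_restrict hQ'm, hzero] with z h1 h2
    rw [h1, h2]
    rfl
  have hle : (μ.restrict Q').map L ≤ μ.map L :=
    Measure.map_mono Measure.restrict_le_self (measurable_clm L)
  -- The restricted projection is smaller, so it has finite density wherever `μ.map L` does; being
  -- singular, it does not charge such points.
  have h0 : (μ.restrict Q').map L (finiteDensitySet (μ.map L)) = 0 := by
    refine measure_mono_null ?_ (measure_finiteDensitySet_of_mutuallySingular _ hsing)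
    rintro z ⟨M, k, h⟩
    exact ⟨M, k, fun ρ h0 hρ => (hle _).trans (h ρ h0 hρ)⟩
  refine mutuallySingular_of_measure_finiteDensitySet _ ?_
  rw [Measure.map_apply (measurable_clm L) (measurableSet_finiteDensitySet _)] at h0 ⊢
  rw [Measure.restrict_apply' hQ'm] at h0
  refine measure_mono_null (t := L ⁻¹' finiteDensitySet (μ.map L) ∩ Q' ∪
    {x | ¬ (L x ∈ finiteDensitySet (μ.map L) → x ∈ Q')}) ?_ (measure_union_null h0 hcover)
  intro x hx
  by_cases hxQ : x ∈ Q'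
  · exact Or.inl ⟨hx, hxQ⟩
  · exact Or.inr fun h => hxQ (h hx)

/-- Measures on purely unrectifiable sets with atomic slices have singular projections. -/
theorem ae_mutuallySingular_of_isPurelyUnrectifiable {μ : Measure (Euc n)} [IsFiniteMeasure μ]
    {E : Set (Euc n)} (hE : IsPurelyUnrectifiable m E) (hμE : IsConcentratedOn μ E) :
    ∀ᵐ (L : Euc n →L[ℝ] Euc m) ∂(clmHaar n m),
      (∃ κ : Kernel (Euc m) (Euc n), IsDisintegration μ L κ ∧ ∀ᵐ y, IsPurelyAtomic (κ y)) →
        (μ.map L).MutuallySingular volume := by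
  filter_upwards [ae_ae_coneBound m μ] with L hL ⟨κ, hκ, hat⟩
  refine mutuallySingular_of_coneBound (c := 2 ^ (m + 1)) hE hμE hκ hat ?_
  filter_upwards [hL, hκ.ae_smallAnnuli] with x h1 h2 hFD i l
  exact h1 hFD i l (h2 hFD i _ (by positivity))

end Unrectifiable

/-! ### Hausdorff measure of images -/

section HausdorffImages

variable {n m : ℕ}

instance isAddHaarMeasure_hausdorffMeasure_euc (m : ℕ) :
    Measure.IsAddHaarMeasure (μH[(m : ℝ)] : Measure (Euc m)) := by
  simpa using isAddHaarMeasure_hausdorffMeasure (E := Euc m)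

/-- The inequality makes `p` constant on the fibres of `q` in `u`, so `p` factors through a
`K`-Lipschitz map on `q '' u`, even if `q` is not injective. -/
theorem hausdorffMeasure_image_le_of_dist_le {α β γ : Type*} [MetricSpace β] [MeasurableSpace β]
    [BorelSpace β] [MetricSpace γ] [MeasurableSpace γ] [BorelSpace γ] {p : α → β} {q : α → γ}
    {K : ℝ≥0} {u : Set α} (h : ∀ x ∈ u, ∀ y ∈ u, dist (p x) (p y) ≤ K * dist (q x) (q y))
    {d : ℝ} (hd : 0 ≤ d) : μH[d] (p '' u) ≤ (K : ℝ≥0∞) ^ d * μH[d] (q '' u) := by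
  rcases u.eq_empty_or_nonempty with rfl | ⟨x₀, -⟩
  · simp
  have : Nonempty α := ⟨x₀⟩
  set g : γ → α := Function.invFunOn q u
  have hg : ∀ w ∈ q '' u, g w ∈ u ∧ q (g w) = w := fun w hw =>
    ⟨Function.invFunOn_mem hw, Function.invFunOn_eq hw⟩
  have hlip : LipschitzOnWith K (fun w => p (g w)) (q '' u) := by
    refine LipschitzOnWith.of_dist_le_mul fun v hv w hw => ?_
    have := h _ (hg v hv).1 _ (hg w hw).1
    rwa [(hg v hv).2, (hg w hw).2] at this
  refine (measure_mono ?_).trans (hlip.hausdorffMeasure_image_le hd)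
  rintro _ ⟨x, hx, rfl⟩
  refine ⟨q x, mem_image_of_mem q hx, ?_⟩
  have h1 := hg (q x) (mem_image_of_mem q hx)
  have h2 := h _ h1.1 x hx
  rw [h1.2, dist_self, mul_zero] at h2
  exact dist_le_zero.1 h2

/-- A map approximated by a linear map with a kernel contracts the Hausdorff measure. -/
theorem hausdorffMeasure_image_le_of_approximatesLinearOn {f : Euc m → Euc n}
    {A : Euc m →L[ℝ] Euc n} (hA : ¬ Function.Injective A) {δ : ℝ≥0} (hδ : 0 < δ) (hδ1 : δ ≤ 1)
    {u : Set (Euc m)} (hf : ApproximatesLinearOn f A u δ) :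
    μH[(m : ℝ)] (f '' u) ≤ (‖A‖₊ + 1 : ℝ≥0) ^ (m : ℝ) * (δ * μH[(m : ℝ)] u) := by
  obtain ⟨v, hAv, hv⟩ : ∃ v, A v = 0 ∧ ‖v‖ = 1 := by
    obtain ⟨w, hw, hw0⟩ : ∃ w, A w = 0 ∧ w ≠ 0 := by
      by_contra! h
      exact hA ((injective_iff_map_eq_zero A).2 h)
    exact ⟨‖w‖⁻¹ • w, by rw [map_smul, hw, smul_zero], norm_smul_inv_norm hw0⟩
  -- `M` shrinks the kernel direction `v` by `δ` and fixes its complement. So `A ∘ M = A`, `det M =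
  -- δ`, and `δ * ‖w‖ ≤ ‖M w‖` absorbs the approximation error: `f` is Lipschitz as a function of `M
  -- x`.
  set M := LinearMap.transvection (((δ : ℝ) - 1) • (innerSL ℝ v : Euc m →L[ℝ] ℝ).toLinearMap) v
    with hM
  have hMw : ∀ w, M w = w + (((δ : ℝ) - 1) * inner ℝ v w) • v := fun w => rfl
  have hvv : inner ℝ v v = (1 : ℝ) := by rw [real_inner_self_eq_norm_sq, hv, one_pow]
  have hdet : LinearMap.det M = δ := by
    rw [hM, LinearMap.transvection.det]
    change 1 + ((δ : ℝ) - 1) * inner ℝ v v = δ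
    rw [hvv]; ring
  have hδ' : (0 : ℝ) < δ := hδ
  have hδ1' : (δ : ℝ) ≤ 1 := hδ1
  have hMlow : ∀ w, δ * ‖w‖ ≤ ‖M w‖ := by
    intro w
    have h1 : inner ℝ v (M w) = δ * inner ℝ v w := by
      rw [hMw, inner_add_right, inner_smul_right, hvv]; ring
    have h2 : (δ : ℝ) • w = (δ : ℝ) • M w + ((1 - δ) * inner ℝ v (M w)) • v := by
      rw [h1, hMw, smul_add, smul_smul, add_assoc, ← add_smul]
      rw [show (δ : ℝ) * ((δ - 1) * inner ℝ v w) + (1 - δ) * (δ * inner ℝ v w) = 0 by ring]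
      simp
    have h3 : |inner ℝ v (M w)| ≤ ‖M w‖ := by
      have := abs_real_inner_le_norm v (M w)
      rwa [hv, one_mul] at this
    calc (δ : ℝ) * ‖w‖ = ‖(δ : ℝ) • w‖ := by rw [norm_smul, Real.norm_of_nonneg hδ'.le]
      _ ≤ ‖(δ : ℝ) • M w‖ + ‖((1 - δ) * inner ℝ v (M w)) • v‖ := by rw [h2]; exact norm_add_le _ _
      _ = δ * ‖M w‖ + (1 - δ) * |inner ℝ v (M w)| := by
          rw [norm_smul, norm_smul, hv, mul_one, Real.norm_of_nonneg hδ'.le, norm_mul,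
            Real.norm_of_nonneg (by linarith), Real.norm_eq_abs]
      _ ≤ δ * ‖M w‖ + (1 - δ) * ‖M w‖ := by
          gcongr
      _ = ‖M w‖ := by ring
  have hdist : ∀ x ∈ u, ∀ y ∈ u, dist (f x) (f y) ≤ (‖A‖₊ + 1 : ℝ≥0) * dist (M x) (M y) := by
    intro x hx y hy
    have h1 := hf x hx y hy
    have h2 : A (x - y) = A (M (x - y)) := by rw [hMw, map_add, map_smul, hAv, smul_zero, add_zero]
    rw [dist_eq_norm, dist_eq_norm, ← map_sub]
    calc ‖f x - f y‖ ≤ ‖f x - f y - A (x - y)‖ + ‖A (x - y)‖ := by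
          have := norm_add_le (f x - f y - A (x - y)) (A (x - y))
          rwa [sub_add_cancel] at this
      _ ≤ δ * ‖x - y‖ + ‖A‖ * ‖M (x - y)‖ := by
          gcongr
          rw [h2]; exact A.le_opNorm _
      _ ≤ ‖M (x - y)‖ + ‖A‖ * ‖M (x - y)‖ := by gcongr; exact hMlow _
      _ = _ := by push_cast; ring
  refine (hausdorffMeasure_image_le_of_dist_le hdist (by positivity)).trans_eq ?_
  rw [Measure.addHaar_image_linearMap, hdet, abs_of_pos hδ', ENNReal.ofReal_coe_nnreal]

/-- Sard's theorem for sets of points at which the derivative is not injective. -/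
theorem hausdorffMeasure_image_eq_zero_of_not_injective {f : Euc m → Euc n} {s : Set (Euc m)}
    {f' : Euc m → Euc m →L[ℝ] Euc n} (hf : ∀ x ∈ s, HasFDerivAt f (f' x) x)
    (hs : ∀ x ∈ s, ¬ Function.Injective (f' x)) : μH[(m : ℝ)] (f '' s) = 0 := by
  have hbdd : ∀ k : ℕ, μH[(m : ℝ)] (f '' (s ∩ closedBall 0 (k : ℝ))) = 0 := by
    intro k
    set s₀ := s ∩ closedBall (0 : Euc m) (k : ℝ) with hs₀
    rcases s₀.eq_empty_or_nonempty with h | hne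
    · rw [h]; simp
    have hle : ∀ ε : ℝ≥0, 0 < ε →
        μH[(m : ℝ)] (f '' s₀) ≤ ε * μH[(m : ℝ)] (closedBall (0 : Euc m) (k : ℝ)) := by
      intro ε hε
      -- Chosen so that the contraction factor `(‖A‖ + 1) ^ m * r A` is at most `ε`.
      set r : (Euc m →L[ℝ] Euc n) → ℝ≥0 := fun A => min 1 (ε / (‖A‖₊ + 1) ^ m) with hr
      have hrpos : ∀ A, 0 < r A := fun A => lt_min one_pos (by positivity)
      obtain ⟨t, A, hdisj, htm, hcov, happ, hA⟩ :=
        exists_partition_approximatesLinearOn_of_hasFDerivWithinAt f s₀ f'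
          (fun x hx => (hf x hx.1).hasFDerivWithinAt) r fun A => (hrpos A).ne'
      calc μH[(m : ℝ)] (f '' s₀) ≤ μH[(m : ℝ)] (⋃ j, f '' (s₀ ∩ t j)) := by
            refine measure_mono ?_
            rintro _ ⟨x, hx, rfl⟩
            obtain ⟨j, hj⟩ := mem_iUnion.1 (hcov hx)
            exact mem_iUnion.2 ⟨j, mem_image_of_mem f ⟨hx, hj⟩⟩
        _ ≤ ∑' j, μH[(m : ℝ)] (f '' (s₀ ∩ t j)) := measure_iUnion_le _
        _ ≤ ∑' j, ε * μH[(m : ℝ)] (closedBall (0 : Euc m) (k : ℝ) ∩ t j) := by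
            refine ENNReal.tsum_le_tsum fun j => ?_
            obtain ⟨y, hy, hAy⟩ := hA hne j
            refine (hausdorffMeasure_image_le_of_approximatesLinearOn (by rw [hAy]; exact hs y hy.1)
              (hrpos _) (min_le_left _ _) (happ j)).trans ?_
            rw [← mul_assoc, ENNReal.rpow_natCast]
            refine mul_le_mul' ?_ (measure_mono (inter_subset_inter_left _ inter_subset_right))
            norm_cast
            calc (‖A j‖₊ + 1) ^ m * r (A j) ≤ (‖A j‖₊ + 1) ^ m * (ε / (‖A j‖₊ + 1) ^ m) := by
                  gcongr; exact min_le_right _ _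
              _ = ε := mul_div_cancel₀ _ (by positivity)
        _ = ε * μH[(m : ℝ)] (⋃ j, closedBall (0 : Euc m) (k : ℝ) ∩ t j) := by
            rw [ENNReal.tsum_mul_left, measure_iUnion]
            · exact fun i j hij => (hdisj hij).mono inter_subset_right inter_subset_right
            · exact fun j => measurableSet_closedBall.inter (htm j)
        _ ≤ _ := by
            gcongr
            exact iUnion_subset fun j => inter_subset_left
    have hfin : μH[(m : ℝ)] (closedBall (0 : Euc m) (k : ℝ)) ≠ ∞ := measure_closedBall_lt_top.ne
    have hlim : Tendsto (fun j : ℕ => (((1 : ℝ≥0) / (j + 1) : ℝ≥0) : ℝ≥0∞) *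
        μH[(m : ℝ)] (closedBall (0 : Euc m) (k : ℝ))) atTop (𝓝 0) := by
      have h1 : Tendsto (fun l : ℕ => (1 : ℝ≥0) / (l + 1)) atTop (𝓝 0) :=
        tendsto_one_div_add_atTop_nhds_zero_nat
      simpa using ENNReal.Tendsto.mul_const (ENNReal.tendsto_coe.2 h1) (Or.inr hfin)
    exact le_antisymm (ge_of_tendsto' hlim fun j => hle _ (by positivity)) zero_le
  have : f '' s = ⋃ k : ℕ, f '' (s ∩ closedBall 0 (k : ℝ)) := by
    rw [← image_iUnion, ← inter_iUnion, iUnion_closedBall_nat, inter_univ]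
  rw [this]
  exact measure_iUnion_null hbdd

/-- A map whose derivative is injective at the points of a set does not collapse the set. -/
theorem hausdorffMeasure_eq_zero_of_injective {g : Euc m → Euc n} {s : Set (Euc m)}
    {g' : Euc m → Euc m →L[ℝ] Euc n} (hg : ∀ x ∈ s, HasFDerivAt g (g' x) x)
    (hs : ∀ x ∈ s, Function.Injective (g' x)) {d : ℝ} (hd : 0 ≤ d) (h0 : μH[d] (g '' s) = 0) :
    μH[d] s = 0 := by
  rcases s.eq_empty_or_nonempty with rfl | hne
  · simp
  have hr : ∀ A : Euc m →L[ℝ] Euc n, ∃ c : ℝ≥0, 0 < c ∧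
      (Function.Injective A → ∀ w, 2 * c * ‖w‖ ≤ ‖A w‖) := by
    intro A
    by_cases hA : Function.Injective A
    · obtain ⟨K, hK, hanti⟩ := (A : Euc m →ₗ[ℝ] Euc n).injective_iff_antilipschitz.1 hA
      refine ⟨K⁻¹ / 2, by positivity, fun _ w => ?_⟩
      have := ZeroHomClass.bound_of_antilipschitz (A : Euc m →ₗ[ℝ] Euc n) hanti w
      push_cast
      rw [mul_div_cancel₀ _ (two_ne_zero), inv_mul_le_iff₀ (by exact_mod_cast hK)]
      exact this
    · exact ⟨1, one_pos, fun h => absurd h hA⟩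
  choose r hrpos hr using hr
  obtain ⟨t, A, -, -, hcov, happ, hA⟩ :=
    exists_partition_approximatesLinearOn_of_hasFDerivWithinAt g s g'
      (fun x hx => (hg x hx).hasFDerivWithinAt) r fun A => (hrpos A).ne'
  refine measure_mono_null (t := ⋃ j, s ∩ t j) (fun x hx => ?_) (measure_iUnion_null fun j => ?_)
  · obtain ⟨j, hj⟩ := mem_iUnion.1 (hcov hx)
    exact mem_iUnion.2 ⟨j, hx, hj⟩
  · obtain ⟨y, hy, hAy⟩ := hA hne j
    have hinj := hr (A j) (by rw [hAy]; exact hs y hy)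
    have hpos : (0 : ℝ) < r (A j) := hrpos (A j)
    have h1 := hausdorffMeasure_image_le_of_dist_le (p := id) (q := g) (K := (r (A j))⁻¹)
      (u := s ∩ t j) (fun x hx y hy => ?_) hd
    · rw [image_id, measure_mono_null (image_mono inter_subset_left) h0, mul_zero] at h1
      exact le_antisymm h1 zero_le
    · have h2 := happ j x hx y hy
      have h3 := hinj (x - y)
      have h4 := norm_sub_norm_le (A j (x - y)) (g x - g y)
      rw [norm_sub_rev (A j (x - y)) (g x - g y)] at h4
      rw [id, id, dist_eq_norm, dist_eq_norm]
      push_cast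
      rw [le_inv_mul_iff₀ hpos]
      linarith

end HausdorffImages

/-! ### Measures with singular projections -/

section SingularProjections

variable {n m : ℕ}

/-- For a left inverse `L₁` of `B`, `(L + t • L₁) ∘ B = L ∘ B + t • id` is injective unless `-t` is
one of the finitely many eigenvalues of `L ∘ B`. Fubini along the line spanned by `L₁` concludes. -/
theorem ae_injective_comp {B : Euc m →L[ℝ] Euc n} (hB : Function.Injective B) :
    ∀ᵐ (L : Euc n →L[ℝ] Euc m) ∂(clmHaar n m), Function.Injective (L.comp B) := by
  obtain ⟨L₀, hL₀⟩ := (B : Euc m →ₗ[ℝ] Euc n).exists_leftInverse_of_injective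
    (LinearMap.ker_eq_bot.2 hB)
  set L₁ : Euc n →L[ℝ] Euc m := LinearMap.toContinuousLinearMap L₀
  have hL₁ : ∀ y, L₁ (B y) = y := fun y => LinearMap.congr_fun hL₀ y
  have hopen : IsOpen {L : Euc n →L[ℝ] Euc m | Function.Injective (L.comp B)} :=
    (ContinuousLinearMap.isOpen_injective (𝕜 := ℝ) (E := Euc m) (F := Euc m)).preimage
      (by fun_prop : Continuous fun L : Euc n →L[ℝ] Euc m => L.comp B)
  refine ae_mem_of_ae_add_linearMap_mem (LinearMap.toSpanSingleton ℝ (Euc n →L[ℝ] Euc m) L₁)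
    volume (clmHaar n m) hopen.measurableSet fun L => ?_
  have hfin := (Module.End.finite_hasEigenvalue
    ((L.comp B : Euc m →L[ℝ] Euc m) : Module.End ℝ (Euc m))).preimage (neg_injective.injOn)
  have h0 := (hfin.measure_zero volume)
  filter_upwards [measure_eq_zero_iff_ae_notMem.1 h0] with t ht
  refine (injective_iff_map_eq_zero _).2 fun y hy => ?_
  by_contra hne
  refine ht ?_
  refine Module.End.hasEigenvalue_of_hasEigenvector (x := y) ⟨Module.End.mem_eigenspace_iff.2 ?_, hne⟩
  have h2 : L (B y) + t • L₁ (B y) = 0 := hy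
  rw [hL₁] at h2
  rw [neg_smul]
  exact eq_neg_of_add_eq_zero_left h2

/-- A measure with singular projections under sufficiently many linear maps is concentrated on a
purely unrectifiable set. -/
theorem exists_isPurelyUnrectifiable_of_mutuallySingular {μ : Measure (Euc n)}
    {S : Set (Euc n →L[ℝ] Euc m)} (hS : ¬ ∀ᵐ L ∂(clmHaar n m), L ∉ S)
    (hsing : ∀ L ∈ S, (μ.map L).MutuallySingular volume) :
    ∃ A : Set (Euc n), IsPurelyUnrectifiable m A ∧ IsConcentratedOn μ A := by
  set O : S → Set (Euc m →L[ℝ] Euc n) := fun L =>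
    {B | Function.Injective ((L : Euc n →L[ℝ] Euc m).comp B)} with hO
  have hOo : ∀ L, IsOpen (O L) := fun L =>
    (ContinuousLinearMap.isOpen_injective (𝕜 := ℝ) (E := Euc m) (F := Euc m)).preimage
      (by fun_prop : Continuous fun B : Euc m →L[ℝ] Euc n => (L : Euc n →L[ℝ] Euc m).comp B)
  -- Lindelöf: the open sets `O L` with `L ∈ S` cover the injective maps because `S` is not null,
  -- and a countable subfamily has the same union.
  obtain ⟨T, hT, hTO⟩ := TopologicalSpace.isOpen_iUnion_countable O hOo
  have hex : ∀ B : Euc m →L[ℝ] Euc n, Function.Injective B → ∃ L ∈ T, B ∈ O L := by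
    intro B hB
    obtain ⟨L, hL, hLB⟩ : ∃ L ∈ S, Function.Injective (L.comp B) := by
      by_contra! h
      refine hS ?_
      filter_upwards [ae_injective_comp hB] with L hL hLS using h L hLS hL
    have : B ∈ ⋃ L, O L := mem_iUnion.2 ⟨⟨L, hL⟩, hLB⟩
    rw [← hTO] at this
    simpa using this
  choose Z hZm hZ0 hZ using fun L : S => hsing L L.2
  refine ⟨⋂ L ∈ T, (L : Euc n →L[ℝ] Euc m) ⁻¹' (Z L)ᶜ, ?_, ?_⟩
  · rintro R ⟨-, D, f, -, hf, rfl⟩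
    set A := ⋂ L ∈ T, (L : Euc n →L[ℝ] Euc m) ⁻¹' (Z L)ᶜ
    rw [inter_iUnion]
    refine measure_iUnion_null fun j => ?_
    obtain ⟨K, hK⟩ := hf j
    obtain ⟨g, hg, hfg⟩ := hK.extend_finite_dimension
    have himage : ∀ u : Set (Euc m), μH[(m : ℝ)] u = 0 → μH[(m : ℝ)] (g '' u) = 0 := by
      intro u hu
      have := (hg.lipschitzOnWith (s := u)).hausdorffMeasure_image_le (d := m) (by positivity)
      rw [hu, mul_zero] at this
      exact le_antisymm this zero_le
    set s₁ := {x | DifferentiableAt ℝ g x ∧ ¬ Function.Injective (fderiv ℝ g x)} with hs₁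
    set s₂ : S → Set (Euc m) := fun L =>
      {x | g x ∈ A ∧ DifferentiableAt ℝ g x ∧ fderiv ℝ g x ∈ O L} with hs₂
    have hsub : A ∩ f j '' D j ⊆
        g '' {x | ¬ DifferentiableAt ℝ g x} ∪ g '' s₁ ∪ ⋃ L ∈ T, g '' s₂ L := by
      rintro _ ⟨hxA, x, hx, rfl⟩
      rw [hfg hx] at hxA ⊢
      by_cases hd : DifferentiableAt ℝ g x
      · by_cases hi : Function.Injective (fderiv ℝ g x)
        · obtain ⟨L, hL, hxL⟩ := hex _ hi
          exact Or.inr (mem_biUnion hL (mem_image_of_mem g ⟨hxA, hd, hxL⟩))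
        · exact Or.inl (Or.inr (mem_image_of_mem g ⟨hd, hi⟩))
      · exact Or.inl (Or.inl (mem_image_of_mem g hd))
    refine measure_mono_null hsub (measure_union_null (measure_union_null ?_ ?_) ?_)
    · exact himage _ (ae_iff.1 (hg.ae_differentiableAt (μ := μH[(m : ℝ)])))
    · exact hausdorffMeasure_image_eq_zero_of_not_injective (f' := fderiv ℝ g)
        (fun x hx => hx.1.hasFDerivAt) fun x hx => hx.2
    -- `L ∘ g` has injective derivative on `s₂ L` and maps it into the null set `(Z L)ᶜ`, so `s₂ L`
    -- itself is null.
    · refine (measure_biUnion_null_iff hT).2 fun L hL => himage _ ?_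
      refine hausdorffMeasure_eq_zero_of_injective
        (g := fun x => (L : Euc n →L[ℝ] Euc m) (g x))
        (g' := fun x => (L : Euc n →L[ℝ] Euc m).comp (fderiv ℝ g x))
        (fun x hx => (L : Euc n →L[ℝ] Euc m).hasFDerivAt.comp x hx.2.1.hasFDerivAt)
        (fun x hx => hx.2.2) (by positivity) ?_
      refine Measure.absolutelyContinuous_isAddHaarMeasure μH[(m : ℝ)] volume
        (measure_mono_null ?_ (hZ L))
      rintro _ ⟨x, hx, rfl⟩
      exact mem_iInter₂.1 hx.1 L hL
  · rw [IsConcentratedOn, compl_iInter₂]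
    refine (measure_biUnion_null_iff hT).2 fun L _ => ?_
    rw [preimage_compl, compl_compl, ← Measure.map_apply (measurable_clm _) (hZm L)]
    exact hZ0 L

end SingularProjections

/-! ### The Grassmannian and linear maps -/

section Grassmannian

variable {n m : ℕ}

/-- The orthogonal complement of the kernel of a surjective linear map. -/
noncomputable def grOfMap (L : Euc n →L[ℝ] Euc m) (hL : Function.Surjective L) : Gr n m :=
  ⟨(LinearMap.ker (L : Euc n →ₗ[ℝ] Euc m))ᗮ, by
    have h1 := (LinearMap.ker (L : Euc n →ₗ[ℝ] Euc m)).finrank_add_finrank_orthogonal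
    have h2 := (L : Euc n →ₗ[ℝ] Euc m).finrank_range_add_finrank_ker
    have h3 := (LinearEquiv.ofTop _ (LinearMap.range_eq_top.2 hL)).finrank_eq
    rw [finrank_euclideanSpace_fin] at h1 h2 h3
    rw [h3, add_comm] at h2
    exact Nat.add_left_cancel (h1.trans h2.symm)⟩

theorem grOfMap_plane (L : Euc n →L[ℝ] Euc m) (hL : Function.Surjective L) :
    (grOfMap L hL).plane = (LinearMap.ker (L : Euc n →ₗ[ℝ] Euc m))ᗮ := rfl

theorem Gr.ext_plane {V W : Gr n m} (h : V.plane = W.plane) : V = W := Subtype.ext h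

instance Gr.instT2Space : T2Space (Gr n m) := by
  refine T2Space.of_injective_continuous
    (f := fun V : Gr n m => V.plane.starProjection) (fun V W h => ?_) continuous_induced_dom
  exact Gr.ext_plane (Submodule.starProjection_inj.1 h)

theorem Gr.exists_rotate_eq (h : m ≤ n) (V : Gr n m) :
    ∃ g : OrthGroup n, Gr.rotate g (Gr.coord h) = V := by
  let W := (Gr.coord h : Gr n m).plane
  have hW : Module.finrank ℝ W = Module.finrank ℝ V.plane := (Gr.coord h : Gr n m).2.trans V.2.symm
  let e : W ≃ₗᵢ[ℝ] V.plane :=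
    (stdOrthonormalBasis ℝ W).equiv (stdOrthonormalBasis ℝ V.plane) (finCongr hW)
  let f : Euc n →ₗᵢ[ℝ] Euc n := (V.plane.subtypeₗᵢ.comp e.toLinearIsometry).extend
  let F : Euc n ≃ₗᵢ[ℝ] Euc n := f.toLinearIsometryEquiv rfl
  refine ⟨Unitary.linearIsometryEquiv.symm F, Gr.ext_plane ?_⟩
  have hF : ∀ w : W, F w = e w := fun w =>
    LinearIsometry.extend_apply (V.plane.subtypeₗᵢ.comp e.toLinearIsometry) w
  change W.map (Unitary.linearIsometryEquiv (Unitary.linearIsometryEquiv.symm F)).toLinearEquiv.toLinearMap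
    = V.plane
  rw [MulEquiv.apply_symm_apply]
  ext x
  constructor
  · rintro ⟨w, hw, rfl⟩
    have := hF ⟨w, hw⟩
    change F w ∈ V.plane
    rw [this]
    exact (e ⟨w, hw⟩).2
  · intro hx
    refine ⟨e.symm ⟨x, hx⟩, (e.symm ⟨x, hx⟩).2, ?_⟩
    change F (e.symm ⟨x, hx⟩) = x
    rw [hF, e.apply_symm_apply]

theorem Gr.rotate_mul (g h : OrthGroup n) (V : Gr n m) :
    Gr.rotate (g * h) V = Gr.rotate g (Gr.rotate h V) := by
  refine Gr.ext_plane ?_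
  change V.plane.map _ = (V.plane.map _).map _
  rw [← Submodule.map_comp, map_mul]
  rfl

/-- The action of the orthogonal group on linear maps by precomposition with the inverse. -/
noncomputable def precompInv (g : OrthGroup n) : (Euc n →L[ℝ] Euc m) →ₗ[ℝ] (Euc n →L[ℝ] Euc m) where
  toFun L := L.comp (star (g : Euc n →L[ℝ] Euc n))
  map_add' L M := by ext1; rfl
  map_smul' c L := by ext1; rfl

theorem precompInv_apply_apply (g : OrthGroup n) (L : Euc n →L[ℝ] Euc m) (x : Euc n) :
    precompInv g L ((g : Euc n →L[ℝ] Euc n) x) = L x :=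
  congrArg L (congr($(Unitary.star_mul_self g).val x))

theorem apply_star_apply (g : OrthGroup n) (x : Euc n) :
    (g : Euc n →L[ℝ] Euc n) (star (g : Euc n →L[ℝ] Euc n) x) = x :=
  congr($(Unitary.mul_star_self g).val x)

theorem precompInv_surjective (g : OrthGroup n) :
    Function.Surjective (precompInv g : (Euc n →L[ℝ] Euc m) →ₗ[ℝ] (Euc n →L[ℝ] Euc m)) := by
  refine fun L => ⟨L.comp (g : Euc n →L[ℝ] Euc n), ?_⟩
  ext1 x
  exact congrArg L (apply_star_apply g x)

theorem continuous_precompInv :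
    Continuous fun p : OrthGroup n × (Euc n →L[ℝ] Euc m) => precompInv p.1 p.2 := by
  change Continuous fun p : OrthGroup n × (Euc n →L[ℝ] Euc m) =>
    p.2.comp (star (p.1 : Euc n →L[ℝ] Euc n))
  fun_prop

theorem surjective_precompInv_iff (g : OrthGroup n) (L : Euc n →L[ℝ] Euc m) :
    Function.Surjective (precompInv g L) ↔ Function.Surjective L := by
  constructor
  · intro h y
    obtain ⟨x, hx⟩ := h y
    exact ⟨_, hx⟩
  · intro h y
    obtain ⟨x, hx⟩ := h y
    exact ⟨(g : Euc n →L[ℝ] Euc n) x, by rw [precompInv_apply_apply, hx]⟩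

theorem grOfMap_precompInv (g : OrthGroup n) (L : Euc n →L[ℝ] Euc m) (hL : Function.Surjective L) :
    grOfMap (precompInv g L) ((surjective_precompInv_iff g L).2 hL) =
      Gr.rotate g (grOfMap L hL) := by
  refine Gr.ext_plane ?_
  change (LinearMap.ker _)ᗮ = (LinearMap.ker (L : Euc n →ₗ[ℝ] Euc m))ᗮ.map
    (Unitary.linearIsometryEquiv g).toLinearEquiv.toLinearMap
  refine Eq.trans ?_ (Submodule.map_orthogonal_equiv _ (Unitary.linearIsometryEquiv g)).symm
  congr 1
  ext x
  constructor
  · intro hx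
    exact ⟨star (g : Euc n →L[ℝ] Euc n) x, hx, apply_star_apply g x⟩
  · rintro ⟨w, hw, rfl⟩
    exact (precompInv_apply_apply g L w).trans hw

theorem isUnit_comp_adjoint_iff (L : Euc n →L[ℝ] Euc m) :
    IsUnit (L.comp (ContinuousLinearMap.adjoint L)) ↔ Function.Surjective L := by
  rw [ContinuousLinearMap.isUnit_iff_bijective]
  constructor
  · intro h y
    obtain ⟨x, hx⟩ := h.2 y
    exact ⟨_, hx⟩
  · intro h
    have hinj : Function.Injective (L.comp (ContinuousLinearMap.adjoint L)) := by
      refine (injective_iff_map_eq_zero _).2 fun y hy => ?_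
      have h1 : ContinuousLinearMap.adjoint L y = 0 := by
        have : inner ℝ (ContinuousLinearMap.adjoint L y) (ContinuousLinearMap.adjoint L y) = 0 := by
          rw [ContinuousLinearMap.adjoint_inner_left]
          change inner ℝ y ((L.comp (ContinuousLinearMap.adjoint L)) y) = 0
          rw [hy, inner_zero_right]
        exact inner_self_eq_zero.1 this
      obtain ⟨x, rfl⟩ := h y
      have : inner ℝ (L x) (L x) = (0 : ℝ) := by
        rw [← ContinuousLinearMap.adjoint_inner_left, h1, inner_zero_left]
      exact inner_self_eq_zero.1 this
    exact ⟨hinj, (LinearMap.injective_iff_surjective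
      (f := (L.comp (ContinuousLinearMap.adjoint L) : Euc m →ₗ[ℝ] Euc m))).1 hinj⟩

/-- The formula `L* (L L*)⁻¹ L` shows that the row space depends continuously on `L`. -/
theorem starProjection_grOfMap (L : Euc n →L[ℝ] Euc m) (hL : Function.Surjective L) :
    (grOfMap L hL).plane.starProjection = (ContinuousLinearMap.adjoint L).comp
      ((Ring.inverse (L.comp (ContinuousLinearMap.adjoint L))).comp L) := by
  have hu := (isUnit_comp_adjoint_iff L).2 hL
  ext1 x
  refine Submodule.eq_starProjection_of_mem_orthogonal ?_ ?_
  · rw [grOfMap_plane, Submodule.mem_orthogonal]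
    intro w hw
    change inner ℝ w (ContinuousLinearMap.adjoint L _) = 0
    rw [ContinuousLinearMap.adjoint_inner_right, show L w = 0 from hw, inner_zero_left]
  · rw [grOfMap_plane, Submodule.orthogonal_orthogonal]
    have := congr($(Ring.mul_inverse_cancel _ hu) (L x))
    change L (x - _) = 0
    rw [map_sub, sub_eq_zero]
    exact this.symm

theorem isOpen_surjective : IsOpen {L : Euc n →L[ℝ] Euc m | Function.Surjective L} := by
  simp only [← isUnit_comp_adjoint_iff]
  exact Units.isOpen.preimage (by fun_prop :
    Continuous fun L : Euc n →L[ℝ] Euc m => L.comp (ContinuousLinearMap.adjoint L))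

theorem continuous_grOfMap : Continuous fun L : {L : Euc n →L[ℝ] Euc m // Function.Surjective L} =>
    grOfMap L.1 L.2 := by
  refine continuous_induced_rng.2 ?_
  have : ((fun V : Gr n m => V.plane.starProjection) ∘
      fun L : {L : Euc n →L[ℝ] Euc m // Function.Surjective L} => grOfMap L.1 L.2) = fun L =>
      (ContinuousLinearMap.adjoint L.1).comp
        ((Ring.inverse (L.1.comp (ContinuousLinearMap.adjoint L.1))).comp L.1) := by
    funext L
    exact starProjection_grOfMap L.1 L.2
  rw [this]
  have hinv : Continuous fun L : {L : Euc n →L[ℝ] Euc m // Function.Surjective L} =>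
      Ring.inverse (L.1.comp (ContinuousLinearMap.adjoint L.1)) := by
    rw [continuous_iff_continuousAt]
    intro L
    have h1 := NormedRing.inverse_continuousAt ((isUnit_comp_adjoint_iff L.1).2 L.2).unit
    rw [IsUnit.unit_spec] at h1
    exact ContinuousAt.comp (f := fun L : {L : Euc n →L[ℝ] Euc m // Function.Surjective L} =>
      L.1.comp (ContinuousLinearMap.adjoint L.1)) h1 (by fun_prop)
  fun_prop

theorem measurableSet_grOfMap {N : Set (Gr n m)} (hN : MeasurableSet N) :
    MeasurableSet {L : Euc n →L[ℝ] Euc m | ∃ hL, grOfMap L hL ∈ N} := by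
  have h := MeasurableSet.subtype_image (isOpen_surjective (n := n) (m := m)).measurableSet
    (continuous_grOfMap.measurable hN)
  convert! h using 1
  ext L
  simp

theorem ae_surjective (h : m ≤ n) :
    ∀ᵐ (L : Euc n →L[ℝ] Euc m) ∂(clmHaar n m), Function.Surjective L := by
  let W := (Gr.coord h : Gr n m).plane
  have hW : Module.finrank ℝ (Euc m) = Module.finrank ℝ W :=
    finrank_euclideanSpace_fin.trans (Gr.coord h : Gr n m).2.symm
  let e : Euc m ≃ₗ[ℝ] W := LinearEquiv.ofFinrankEq _ _ hW
  let B : Euc m →L[ℝ] Euc n := LinearMap.toContinuousLinearMap (W.subtype ∘ₗ e.toLinearMap)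
  have hB : Function.Injective B := W.injective_subtype.comp e.injective
  filter_upwards [ae_injective_comp hB] with L hL
  exact (show Function.Surjective (L ∘ B) from (LinearMap.injective_iff_surjective
    (f := (L.comp B : Euc m →ₗ[ℝ] Euc m))).1 hL).of_comp

/-- The Haar probability measure on the orthogonal group. -/
noncomputable abbrev orthHaar (n : ℕ) : Measure (OrthGroup n) :=
  Measure.haarMeasure (⊤ : TopologicalSpace.PositiveCompacts (OrthGroup n))

/-- Right translations preserve Haar-null sets, so the base plane may be changed within its orbit.
-/
theorem ae_rotate_rotate {V : Gr n m} {Q : Gr n m → Prop}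
    (h : ∀ᵐ g ∂(orthHaar n), Q (Gr.rotate g V)) (k : OrthGroup n) :
    ∀ᵐ g ∂(orthHaar n), Q (Gr.rotate g (Gr.rotate k V)) := by
  have := (quasiMeasurePreserving_mul_right (orthHaar n) k).ae h
  simpa only [Gr.rotate_mul] using this

/-- For non-measurable `Q`, a null preimage does not by itself give a null set in `X`. Compact sets
of almost full measure on which `Q ∘ f` holds have compact, hence measurable, images, on which `Q`
holds. -/
theorem ae_map_of_ae_comp {G X : Type*} [TopologicalSpace G] [T2Space G] [MeasurableSpace G]
    [BorelSpace G] {ν : Measure G} [IsFiniteMeasure ν] [ν.InnerRegularCompactLTTop]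
    [TopologicalSpace X] [T2Space X] [MeasurableSpace X] [BorelSpace X] {f : G → X}
    (hf : Continuous f) {Q : X → Prop} (h : ∀ᵐ g ∂ν, Q (f g)) : ∀ᵐ x ∂(ν.map f), Q x := by
  obtain ⟨Z, hZ, hZm, hZ0⟩ := exists_measurable_superset_of_null (ae_iff.1 h)
  refine le_antisymm (le_of_forall_pos_le_add fun ε hε => ?_) zero_le
  obtain ⟨K, hK, hKc, hlt⟩ := hZm.compl.exists_isCompact_lt_add (measure_ne_top ν _) hε.ne'
  have hKm := (hKc.image hf).measurableSet
  have hsub : {x | ¬ Q x} ⊆ (f '' K)ᶜ := by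
    rintro _ hx ⟨g, hg, rfl⟩
    exact hK hg (hZ hx)
  calc ν.map f {x | ¬ Q x} ≤ ν.map f (f '' K)ᶜ := measure_mono hsub
    _ = ν (f ⁻¹' (f '' K)ᶜ) := Measure.map_apply hf.measurable hKm.compl
    _ ≤ ν Kᶜ := measure_mono fun g hg hgK => hg (mem_image_of_mem f hgK)
    _ ≤ ν Z + ν (Zᶜ \ K) := by
        refine (measure_mono fun g hg => ?_).trans (measure_union_le Z (Zᶜ \ K))
        by_cases hgZ : g ∈ Z
        · exact Or.inl hgZ
        · exact Or.inr ⟨hgZ, hg⟩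
    _ ≤ 0 + ε := by
        rw [hZ0]
        gcongr
        rw [measure_sdiff hK hKc.measurableSet.nullMeasurableSet (measure_ne_top _ _)]
        exact tsub_le_iff_left.2 hlt.le

/-- A property holds for almost every `m`-plane if and only if it holds for the row space of almost
every linear map. -/
theorem ae_grMeasure_iff (h : m ≤ n) {Q : Gr n m → Prop} : (∀ᵐ V ∂(grMeasure h), Q V) ↔
    ∀ᵐ (L : Euc n →L[ℝ] Euc m) ∂(clmHaar n m), ∀ hL, Q (grOfMap L hL) := by
  constructor
  · intro hQ
    obtain ⟨N, hN, hNm, hN0⟩ := exists_measurable_superset_of_null (ae_iff.1 hQ)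
    set B : Set (Euc n →L[ℝ] Euc m) := {L | ∃ hL, grOfMap L hL ∈ N} with hB
    have hBm : MeasurableSet B := measurableSet_grOfMap hNm
    have h1 : ∀ᵐ g ∂(orthHaar n), Gr.rotate g (Gr.coord h) ∉ N := by
      rw [grMeasure, Measure.map_apply (Gr.continuous_rotate _).measurable hNm] at hN0
      exact measure_eq_zero_iff_ae_notMem.1 hN0
    -- For fixed `L` the row space of `precompInv g L` is a random rotation of a fixed plane. By
    -- Fubini some single `g` works for almost every `L`, and precomposition with `g` can be undone
    -- because it preserves null sets.
    have h2 : ∀ L : Euc n →L[ℝ] Euc m, ∀ᵐ g ∂(orthHaar n), precompInv g L ∈ Bᶜ := by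
      intro L
      by_cases hL : Function.Surjective L
      · obtain ⟨k, hk⟩ := Gr.exists_rotate_eq h (grOfMap L hL)
        filter_upwards [ae_rotate_rotate (Q := fun V => V ∉ N) h1 k] with g hg
        rintro ⟨_, hmem⟩
        rw [grOfMap_precompInv g L hL, ← hk] at hmem
        exact hg hmem
      · refine Eventually.of_forall fun g => ?_
        rintro ⟨hs, -⟩
        exact hL ((surjective_precompInv_iff g L).1 hs)
    have h3 : ∀ᵐ g ∂(orthHaar n), ∀ᵐ (L : Euc n →L[ℝ] Euc m) ∂(clmHaar n m),
        precompInv g L ∈ Bᶜ :=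
      (Measure.ae_ae_comm (p := fun g (L : Euc n →L[ℝ] Euc m) => precompInv g L ∈ Bᶜ) (continuous_precompInv.measurable hBm.compl)).2 (Eventually.of_forall h2)
    obtain ⟨g, hg⟩ := h3.exists
    have h4 := (ae_comp_linearMap_mem_iff (precompInv g) (clmHaar n m) (clmHaar n m)
      (precompInv_surjective g) hBm.compl).1 hg
    filter_upwards [h4] with L hLB hL
    by_contra hne
    exact hLB ⟨hL, hN hne⟩
  · intro hQ
    obtain ⟨B, hB, hBm, hB0⟩ := exists_measurable_superset_of_null (ae_iff.1 hQ)
    have h1 : ∀ᵐ (L : Euc n →L[ℝ] Euc m) ∂(clmHaar n m), L ∈ Bᶜ :=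
      measure_eq_zero_iff_ae_notMem.1 hB0
    have h2 : ∀ᵐ (L : Euc n →L[ℝ] Euc m) ∂(clmHaar n m), ∀ᵐ g ∂(orthHaar n),
        precompInv g L ∈ Bᶜ :=
      (Measure.ae_ae_comm (p := fun g (L : Euc n →L[ℝ] Euc m) => precompInv g L ∈ Bᶜ) (continuous_precompInv.measurable hBm.compl)).1
        (Eventually.of_forall fun g => (ae_comp_linearMap_mem_iff (precompInv g) (clmHaar n m)
          (clmHaar n m) (precompInv_surjective g) hBm.compl).2 h1)
    -- Transitivity of the action makes one surjective `L` enough: its rotations already give the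
    -- law of a random plane.
    obtain ⟨L, hLB, hL⟩ := (h2.and (ae_surjective h)).exists
    obtain ⟨k, hk⟩ := Gr.exists_rotate_eq h (grOfMap L hL)
    have h3 : ∀ᵐ g ∂(orthHaar n), Q (Gr.rotate g (Gr.rotate k (Gr.coord h))) := by
      filter_upwards [hLB] with g hg
      rw [hk, ← grOfMap_precompInv g L hL]
      by_contra hne
      exact hg (hB fun hall => hne (hall _))
    have h4 := ae_rotate_rotate (V := Gr.rotate k (Gr.coord h)) h3 k⁻¹
    simp only [← Gr.rotate_mul, inv_mul_cancel, mul_one] at h4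
    exact ae_map_of_ae_comp (Gr.continuous_rotate _) h4

end Grassmannian

/-! ### From linear maps back to orthogonal projections, and the theorem. -/

section Main

variable {n m : ℕ}

/-- A surjective linear map is the projection onto its row space, up to an isomorphism. -/
theorem exists_equiv_comp_proj (L : Euc n →L[ℝ] Euc m) (hL : Function.Surjective L) :
    ∃ e : (grOfMap L hL).plane ≃L[ℝ] Euc m, ∀ x, L x = e ((grOfMap L hL).proj x) := by
  set V := grOfMap L hL with hV
  have hproj : ∀ x, L (V.proj x : Euc n) = L x := by
    intro x
    have h1 : x - (V.plane.starProjection x) ∈ V.planeᗮ := V.plane.sub_starProjection_mem_orthogonal x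
    rw [hV, grOfMap_plane, Submodule.orthogonal_orthogonal] at h1
    have h2 : L (x - V.plane.starProjection x) = 0 := h1
    rw [map_sub, sub_eq_zero] at h2
    exact h2.symm
  let f : V.plane →ₗ[ℝ] Euc m := (L : Euc n →ₗ[ℝ] Euc m) ∘ₗ V.plane.subtype
  have hsurj : Function.Surjective f := fun y => by
    obtain ⟨x, rfl⟩ := hL y
    exact ⟨V.proj x, hproj x⟩
  have hinj : Function.Injective f := by
    refine (LinearMap.injective_iff_surjective_of_finrank_eq_finrank ?_).2 hsurj
    rw [finrank_euclideanSpace_fin]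
    exact V.2
  refine ⟨(LinearEquiv.ofBijective f ⟨hinj, hsurj⟩).toContinuousLinearEquiv, fun x => ?_⟩
  exact (hproj x).symm

instance isAddHaarMeasure_hausdorffMeasure_plane (V : Gr n m) :
    Measure.IsAddHaarMeasure (μH[(m : ℝ)] : Measure V.plane) := by
  have h : Module.finrank ℝ V.plane = m := V.2
  have := isAddHaarMeasure_hausdorffMeasure (E := V.plane)
  rwa [h] at this

theorem Gr.measurable_proj (V : Gr n m) : Measurable V.proj :=
  V.plane.orthogonalProjectionOnto.continuous.measurable

variable {V : Gr n m} {L : Euc n →L[ℝ] Euc m} {e : V.plane ≃L[ℝ] Euc m}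

theorem map_map_proj (he : ∀ x, L x = e (V.proj x)) (μ : Measure (Euc n)) :
    (μ.map V.proj).map e = μ.map L := by
  rw [Measure.map_map e.continuous.measurable V.measurable_proj]
  congr 1
  exact (funext he).symm

/-- The isomorphism `e` carries `ℋ^m` on the plane to a Haar measure on `ℝᵐ`, which has the same
null sets as Lebesgue measure. -/
theorem mutuallySingular_map_proj_iff (he : ∀ x, L x = e (V.proj x)) (μ : Measure (Euc n)) :
    (μ.map V.proj).MutuallySingular μH[(m : ℝ)] ↔ (μ.map L).MutuallySingular volume := by
  rw [← map_map_proj he]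
  constructor
  · intro h
    exact (e.toHomeomorph.measurableEmbedding.mutuallySingular_map h).mono_ac
      Measure.AbsolutelyContinuous.rfl
      (Measure.absolutelyContinuous_isAddHaarMeasure volume (Measure.map e μH[(m : ℝ)]))
  · intro h
    have h1 := e.symm.toHomeomorph.measurableEmbedding.mutuallySingular_map h
    have h2 : ((μ.map V.proj).map e).map e.symm = μ.map V.proj := by
      rw [Measure.map_map e.symm.continuous.measurable e.continuous.measurable]
      simp
    refine Measure.MutuallySingular.mono_ac h1 ?_ ?_
    · exact Measure.absolutelyContinuous_of_eq h2.symm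
    · exact Measure.absolutelyContinuous_isAddHaarMeasure μH[(m : ℝ)]
        (Measure.map e.symm (volume : Measure (Euc m)))

theorem HasAtomicSlices.exists_disintegration (he : ∀ x, L x = e (V.proj x))
    {μ : Measure (Euc n)} (h : HasAtomicSlices μ V) :
    ∃ κ : Kernel (Euc m) (Euc n), IsDisintegration μ L κ ∧ ∀ᵐ y, IsPurelyAtomic (κ y) := by
  obtain ⟨κ, hκ, hat⟩ := h
  have hemb : MeasurableEmbedding e := e.toHomeomorph.measurableEmbedding
  have hsymm : Measurable e.symm := e.symm.continuous.measurable
  refine ⟨κ.comap e.symm hsymm, ⟨fun y => ?_, ?_, fun B hB => ?_⟩, ?_⟩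
  · exact hκ.isProbabilityMeasure _
  · rw [← map_map_proj he]
    refine (hemb.ae_map_iff (p := fun y => IsConcentratedOn (κ.comap e.symm hsymm y)
      (L ⁻¹' {y}))).2 ?_
    filter_upwards [hκ.concentrated] with y hy
    change κ (e.symm (e y)) (L ⁻¹' {e y})ᶜ = 0
    rw [e.symm_apply_apply]
    have hpre : L ⁻¹' {e y} = V.proj ⁻¹' {y} := by
      ext x
      simp [he]
    rw [hpre]
    exact hy
  · rw [← map_map_proj he, hemb.lintegral_map, hκ.integral_eq B hB]
    refine lintegral_congr fun y => ?_
    change κ y B = κ (e.symm (e y)) B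
    rw [e.symm_apply_apply]
  · have h1 : ∀ᵐ y ∂(Measure.map e μH[(m : ℝ)]), IsPurelyAtomic (κ (e.symm y)) := by
      refine (hemb.ae_map_iff (p := fun y => IsPurelyAtomic (κ (e.symm y)))).2 ?_
      filter_upwards [hat] with y hy
      rwa [e.symm_apply_apply]
    exact (Measure.absolutelyContinuous_isAddHaarMeasure volume
      (Measure.map e μH[(m : ℝ)])).ae_le h1

end Main

theorem theorem1p1 (n m : ℕ) (hm : 0 < m) (hmn : m < n)
    (μ : Measure (EuclideanSpace ℝ (Fin n))) [IsFiniteMeasure μ]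
    (Sig : Set (Gr n m)) (hSig : MeasurableSet Sig) (hpos : 0 < grMeasure hmn.le Sig)
    (hat : ∀ᵐ V ∂(grMeasure hmn.le), V ∈ Sig → HasAtomicSlices μ V) :
    (∀ᵐ V ∂(grMeasure hmn.le), V ∈ Sig →
        (μ.map V.proj).MutuallySingular
            (Measure.hausdorffMeasure (m : ℝ) : Measure V.plane) ∧
          ∃ A : Set (EuclideanSpace ℝ (Fin n)), IsConcentratedOn μ A ∧ Set.InjOn V.proj A) ↔
      ∃ A : Set (EuclideanSpace ℝ (Fin n)), IsPurelyUnrectifiable m A ∧ IsConcentratedOn μ A := by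
  constructor
  · intro h
    rw [ae_grMeasure_iff] at h
    refine exists_isPurelyUnrectifiable_of_mutuallySingular (m := m)
      (S := {L | (∃ hL, grOfMap L hL ∈ Sig) ∧ (μ.map L).MutuallySingular volume}) ?_
      fun L hL => hL.2
    -- Were the set of these maps null, almost no plane would belong to `Sig`, against `hpos`.
    intro hS
    have h1 : ∀ᵐ V ∂(grMeasure hmn.le), V ∉ Sig := by
      rw [ae_grMeasure_iff]
      filter_upwards [h, hS] with L hL hLS hsurj hmem
      obtain ⟨e, he⟩ := exists_equiv_comp_proj L hsurj
      exact hLS ⟨⟨hsurj, hmem⟩, (mutuallySingular_map_proj_iff he μ).1 (hL hsurj hmem).1⟩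
    exact hpos.ne' (measure_eq_zero_iff_ae_notMem.2 h1)
  · rintro ⟨E, hE, hμE⟩
    rw [ae_grMeasure_iff] at hat ⊢
    filter_upwards [hat, ae_mutuallySingular_of_isPurelyUnrectifiable hE hμE,
      ae_injOn_of_mutuallySingular m μ] with L h1 h2 h3 hL hmem
    obtain ⟨e, he⟩ := exists_equiv_comp_proj L hL
    have hs := h2 ((h1 hL hmem).exists_disintegration he)
    obtain ⟨A, hA, hinj⟩ := h3 hs
    refine ⟨(mutuallySingular_map_proj_iff he μ).2 hs, A, hA, fun x hx y hy hxy => hinj hx hy ?_⟩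
    rw [he, he, hxy]
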